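/- **Notation.** A partition $\Delta=1^{m_1(\Delta)}2^{m_2(\Delta)}\cdots$ (of any nonnegative integer, possibly $0$) has $|\Delta|=\sum_a a\,m_a(\Delta)$, $l(\Delta)=\sum_a m_a(\Delta)$, $\|\Delta\|=\prod_a a^{m_a(\Delta)}$; sums of partitions add the multiplicities $m_a$. For time variables $p=(p_1,p_2,\dots)$ put $p_\Delta=\prod_a p_a^{m_a(\Delta)}$ and $\frac{\partial}{\partial p_\Delta}=\prod_a\frac{\partial^{m_a(\Delta)}}{\partial p_a^{m_a(\Delta)}}$. **Shifted Hurwitz numbers.** Let $\mu_g^{h,n}(\Delta_1,\dots,\Delta_r)$ be the Hurwitz number counting (with weight $1/|\mathrm{Aut}|$) the degree-$n$ coverings, possibly disconnected, of a closed connected surface of genus $g$ by a surface of genus $h$ (Euler characteristic $2-2h$, $h\in\mathbb Z$), branched over $r$ given points with ramification types $[\Delta_i,1^{n-|\Delta_i|}]$. Equivalently, it is $\frac1{n!}$ times the number of tuples $(a_j,b_j)_{j\le g},(s_i)_{i\le r}$ in $S_n$ with $\prod_j[a_j,b_j]\prod_i s_i=1$, $s_i$ of cycle type $[\Delta_i,1^{n-|\Delta_i|}]$,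 whose covering has genus $h$. It is $0$ if some $|\Delta_i|>n$. Let $$U_g^{h,n}(\Delta_1,\dots,\Delta_r)=\prod_{i=1}^r\binom{n-|\Delta_i|+m_1(\Delta_i)}{m_1(\Delta_i)}\ \mu_g^{h,n}(\Delta_1,\dots,\Delta_r),$$ and let $CU_g^{h,n}$ be the same number counting only coverings with connected (non-empty) source. **Cut-and-join operators.** For a partition $\Delta$ and a formal variable $z$ let $$W(\Delta,z)=\sum_{T}\frac{z^{|\Delta|-l(\Delta)+l(\Gamma')-l(\Gamma)}}{|\mathrm{Aut}(T)|}\prod_i\Big[\|\Gamma'_i\|\,\delta_{|\Gamma_i|,|\Gamma'_i|}\,CU_0^{h_i^+,|\Gamma'_i|}(\Gamma'_i,\Delta^i,\Gamma_i)\Big]\;p_{\Gamma}\frac{\partial}{\partial p_{\Gamma'}},$$ where $T$ runs over all finite unordered collections (multisets) of triples $(\Gamma'_i,\Delta^i,\Gamma_i)$ of partitions with $|\Delta^i|\ge1$ and $\sum_i\Delta^i=\Delta$; $\Gamma'=\sum_i\Gamma'_i$, $\Gamma=\sum_i\Gamma_i$; $|\mathrm{Aut}(T)|$ is the product of the factorials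 of the multiplicities of the triples in $T$; and $2h_i^+-2=|\Delta^i|-l(\Delta^i)-l(\Gamma'_i)-l(\Gamma_i)$. Let $\widetilde W(\Delta,z)$ be the same operator written in the shifted time variables $\tilde p_a=p_a+\delta_{a,1}$, i.e. with $p_\Gamma\frac{\partial}{\partial p_{\Gamma'}}$ replaced by $\tilde p_\Gamma\frac{\partial}{\partial p_{\Gamma'}}$. **Generating functions.** Fix $g,m,k\ge0$ and partitions $\Delta_1,\dots,\Delta_m$. For $n\ge0$ let $$\Phi_{g,n}=\sum_{h\in\mathbb Z}\ \sum_{l_1,\dots,l_m\ge0}\ \sum_{\Gamma_1,\dots,\Gamma_k,\Gamma}z^{2h-2}\,U_g^{h,n}(\underbrace{\Delta_1,\dots,\Delta_1}_{l_1},\dots,\underbrace{\Delta_m,\dots,\Delta_m}_{l_m},\Gamma_1,\dots,\Gamma_k,\Gamma)\prod_{j=1}^m\frac{u_j^{l_j}}{l_j!}\prod_{i=1}^kp^{(i)}_{\Gamma_i}\;p_\Gamma,$$ where $\Gamma_1,\dots,\Gamma_k,\Gamma$ run over all partitions (those of size at most $n$ contribute). Let $\Phi_g=\sum_{n\ge0}\Phi_{g,n}$,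 and let $\Phi_g^{\circ}$ be the part of this sum, over all $n$, with $|\Gamma|=n$. These are formal series in $u_j,p^{(i)}_a,p_a$ whose coefficients are formal sums $\sum_{e\in\mathbb Z}c_ez^e$, $c_e\in\mathbb C$. **Theorem.** For every $i\in\{1,\dots,m\}$: 1. $W(\Delta_i,z)$ and $\widetilde W(\Delta_i,z)$ are well defined on all such formal series: only finitely many terms contribute to each coefficient. 2. If $g\ne1$, then every coefficient of the sum $\Phi_g=\sum_n\Phi_{g,n}$ is a finite sum, and $$\frac{\partial\Phi_g}{\partial u_i}=\widetilde W(\Delta_i,z)\,\Phi_g .$$ 3. For every $g$ (including $g=1$) and every $n\ge0$, $$\frac{\partial\Phi_{g,n}}{\partial u_i}=\widetilde W(\Delta_i,z)\,\Phi_{g,n}.$$ 4. For every $g$, $$\frac{\partial\Phi_g^{\circ}}{\partial u_i}=W(\Delta_i,z)\,\Phi_g^{\circ}.$$ -/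

import Mathlib

open scoped BigOperators Nat

namespace ShiftedHurwitz

noncomputable section

/-! ### Partitions -/

/-- A partition `1^{m_1} 2^{m_2} ⋯` of an arbitrary nonnegative integer, given by its multiplicity
function `a ↦ m_a`.  The sum of two partitions adds multiplicities. The same data is an exponent
of a monomial `p_Γ = ∏ p_a ^ m_a(Γ)` in the time variables `p_1, p_2, …`. -/
abbrev Ptn := ℕ+ →₀ ℕ

/-- `|Δ| = ∑ a m_a(Δ)`. -/
def size (D : Ptn) : ℕ := D.sum fun a k => (a : ℕ) * k

/-- `l(Δ) = ∑ m_a(Δ)`. -/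
def len (D : Ptn) : ℕ := D.sum fun _ k => k

/-- `‖Δ‖ = ∏ a ^ m_a(Δ)`. -/
def partProd (D : Ptn) : ℕ := D.prod fun a k => (a : ℕ) ^ k

/-- The multiset of parts of `[Δ, 1^{n - |Δ|}]`. It is the multiset of parts of a partition of `n`
exactly when `|Δ| ≤ n`. -/
def shiftParts (n : ℕ) (D : Ptn) : Multiset ℕ :=
  D.toMultiset.map (fun a : ℕ+ => (a : ℕ)) + Multiset.replicate (n - size D) 1

/-! ### Hurwitz numbers -/

/-- Monodromy data of a degree `n` covering, with labelled base fibre, of a closed connected surface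
of genus `g`, branched over `r` given points: a homomorphism to `S_n` from the fundamental group
`⟨a_j, b_j, s_i | ∏ [a_j, b_j] ∏ s_i = 1⟩` of the punctured surface. -/
structure Monodromy (g n r : ℕ) where
  a : Fin g → Equiv.Perm (Fin n)
  b : Fin g → Equiv.Perm (Fin n)
  s : Fin r → Equiv.Perm (Fin n)
  rel : (List.ofFn fun j => a j * b j * (a j)⁻¹ * (b j)⁻¹).prod * (List.ofFn s).prod = 1

/-- The Euler characteristic of the covering surface: the punctured base has Euler
characteristic `2 - 2 g - r`, and the points over the `i`-th branch point are the cycles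
(fixed points included) of `s i`. -/
def Monodromy.eulerChar {g n r : ℕ} (M : Monodromy g n r) : ℤ :=
  (n : ℤ) * (2 - 2 * (g : ℤ) - (r : ℤ)) + ∑ i, ((M.s i).partition.parts.card : ℤ)

/-- The covering surface is connected (and non-empty). -/
def Monodromy.IsConnected {g n r : ℕ} (M : Monodromy g n r) : Prop :=
  0 < n ∧ ∀ x y : Fin n, ∃ w ∈ Subgroup.closure (Set.range M.a ∪ Set.range M.b ∪ Set.range M.s),
    w x = y

/-- The covering has degree `n`, a source of genus `h` (that is, of Euler characteristic `2 - 2h`;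
`h` may be negative when the source is disconnected) and ramification type
`[Δ_i, 1^{n - |Δ_i|}]` over the `i`-th branch point. -/
def Monodromy.IsCover {g n : ℕ} (h : ℤ) (L : List Ptn) (M : Monodromy g n L.length) : Prop :=
  M.eulerChar = 2 - 2 * h ∧ ∀ i : Fin L.length, (M.s i).partition.parts = shiftParts n (L.get i)

/-- The classical (possibly disconnected) Hurwitz number `μ_g^{h,n}(Δ_1, …, Δ_k)`: the number of
equivalence classes of coverings, each weighted by the inverse of the order of its automorphism
group, i.e. the number of monodromy data divided by `n!`. -/
def hurwitz (g : ℕ) (h : ℤ) (n : ℕ) (L : List Ptn) : ℂ :=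
  (Nat.card {M : Monodromy g n L.length // M.IsCover h L} : ℂ) / (n ! : ℂ)

/-- The Hurwitz number counting only coverings with connected source. -/
def connHurwitz (g : ℕ) (h : ℤ) (n : ℕ) (L : List Ptn) : ℂ :=
  (Nat.card {M : Monodromy g n L.length // M.IsCover h L ∧ M.IsConnected} : ℂ) / (n ! : ℂ)

/-- `∏_i binom(n - |Δ_i| + m_1(Δ_i), m_1(Δ_i))`. It is only ever multiplied with numbers
that vanish unless `|Δ_i| ≤ n` for all `i`. -/
def shiftFactor (n : ℕ) (L : List Ptn) : ℕ :=
  (L.map fun D => (n - size D + D 1).choose (D 1)).prod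

/-- The shifted Hurwitz number `U_g^{h,n}(Δ_1, …, Δ_k)`. -/
def U (g : ℕ) (h : ℤ) (n : ℕ) (L : List Ptn) : ℂ :=
  (shiftFactor n L : ℂ) * hurwitz g h n L

/-- The connected shifted Hurwitz number `CU_g^{h,n}(Δ_1, …, Δ_k)`. -/
def CU (g : ℕ) (h : ℤ) (n : ℕ) (L : List Ptn) : ℂ :=
  (shiftFactor n L : ℂ) * connHurwitz g h n L

/-! ### Formal series and the elementary operators on them -/

/-- Formal power series in `u_1, …, u_m` and in the time variables `p^{(1)}, …, p^{(k)}, p`, whose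
coefficients are formal sums `∑_{e ∈ ℤ} c_e z^e`: the series `F e l G` in the variables
`p_1, p_2, …` is the coefficient of `z^e ∏ u_j^{l_j} ∏ p^{(i)}_{G_i}`. -/
abbrev Series (m k : ℕ) :=
  ℤ → (Fin m → ℕ) → (Fin k → Ptn) → MvPowerSeries ℕ+ ℂ

/-- `∂ / ∂ u_i`. -/
def partialU {m k : ℕ} (i : Fin m) (F : Series m k) : Series m k :=
  fun e l G => ((l i : ℂ) + 1) • F e (l + Pi.single i 1) G

/-- `∂ / ∂ p_Γ = ∏_a (∂ / ∂ p_a) ^ m_a(Γ)`. -/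
def partialP (Γ : Ptn) (f : MvPowerSeries ℕ+ ℂ) : MvPowerSeries ℕ+ ℂ :=
  fun P => ((Γ.prod fun a k => (P a + k).descFactorial k : ℕ) : ℂ) *
    MvPowerSeries.coeff (P + Γ) f

/-- The monomial `x_Γ = ∏_a x_a ^ m_a(Γ)` in a family `x` of series. -/
def monom (x : ℕ+ → MvPowerSeries ℕ+ ℂ) (Γ : Ptn) : MvPowerSeries ℕ+ ℂ :=
  Γ.prod fun a k => x a ^ k

/-- The time variables `p_a`. -/
def timeVar (a : ℕ+) : MvPowerSeries ℕ+ ℂ := MvPowerSeries.X a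

/-- The shifted time variables `p_a + δ_{a,1}`. Note that `∂ / ∂ (p_a + δ_{a,1}) = ∂ / ∂ p_a`. -/
def shiftedTimeVar (a : ℕ+) : MvPowerSeries ℕ+ ℂ :=
  MvPowerSeries.X a + if a = 1 then 1 else 0

/-! ### The shifted genus expanded cut-and-join operators -/

/-- A triple `(Γ'_i, Δ^i, Γ_i)`. -/
abbrev Triple := Ptn × Ptn × Ptn

/-- The collection `T` of triples is over a proper re-partition of `Δ`: `∑_i Δ^i = Δ` and
`|Δ^i| ≥ 1` for all `i`. -/
def IsProper (D : Ptn) (T : Multiset Triple) : Prop :=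
  (T.map fun t => t.2.1).sum = D ∧ ∀ t ∈ T, 1 ≤ size t.2.1

/-- `Γ' = ∑_i Γ'_i`. -/
def inPart (T : Multiset Triple) : Ptn := (T.map fun t => t.1).sum

/-- `Γ = ∑_i Γ_i`. -/
def outPart (T : Multiset Triple) : Ptn := (T.map fun t => t.2.2).sum

open Classical in
/-- The number of permutations of the collection of triples that fix it, i.e. that permute equal
triples among themselves. -/
def autCard (T : Multiset Triple) : ℕ := ∏ t ∈ T.toFinset, (T.count t)!

/-- The genus `h_i^+` with `2 h_i^+ - 2 = |Δ^i| - l(Δ^i) - l(Γ'_i) - l(Γ_i)`. (If the right-hand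
side is odd, there is no covering of either genus, so the factor in which it occurs is `0`.) -/
def genusPlus (t : Triple) : ℤ :=
  ((size t.2.1 : ℤ) - len t.2.1 - len t.1 - len t.2.2 + 2) / 2

/-- `‖Γ'_i‖ δ_{|Γ_i|,|Γ'_i|} CU_0^{h_i^+,|Γ'_i|}(Γ'_i, Δ^i, Γ_i)`. -/
def tripleCoeff (t : Triple) : ℂ :=
  if size t.2.2 = size t.1 then
    (partProd t.1 : ℂ) * CU 0 (genusPlus t) (size t.1) [t.1, t.2.1, t.2.2]
  else 0

/-- The scalar coefficient of the term of `W(Δ, z)` indexed by the collection `T`. -/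
def collCoeff (T : Multiset Triple) : ℂ := (autCard T : ℂ)⁻¹ * (T.map tripleCoeff).prod

/-- The exponent `|Δ| - l(Δ) + l(Γ') - l(Γ)` of `z` in the term indexed by `T`. -/
def zExp (D : Ptn) (T : Multiset Triple) : ℤ :=
  (size D : ℤ) - len D + len (inPart T) - len (outPart T)

/-- The term of `W(Δ, z)` indexed by the collection `T`, in normal order, applied to `F`:
`coefficient * z ^ zExp * x_Γ ∂F/∂p_{Γ'}`. -/
def cutJoinTerm (x : ℕ+ → MvPowerSeries ℕ+ ℂ) {m k : ℕ} (D : Ptn) (T : Multiset Triple)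
    (F : Series m k) : Series m k :=
  fun e l G => collCoeff T •
    (monom x (outPart T) * partialP (inPart T) (F (e - zExp D T) l G))

/-- The operator `W(Δ, z)` in the variables `x`, which are either the time variables or the shifted
time variables (for both of which the partial derivatives are the `∂ / ∂ p_a`): the sum of
its terms, coefficient by coefficient. -/
def W (x : ℕ+ → MvPowerSeries ℕ+ ℂ) {m k : ℕ} (D : Ptn) (F : Series m k) : Series m k :=
  fun e l G P => ∑ᶠ (T : Multiset Triple) (_ : IsProper D T),
    MvPowerSeries.coeff P (cutJoinTerm x D T F e l G)

/-- The sum that defines `W(Δ, z)` is locally finite: for every series, only finitely many of its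
terms contribute to any given coefficient. -/
def IsLocallyFinite (x : ℕ+ → MvPowerSeries ℕ+ ℂ) (m k : ℕ) (D : Ptn) : Prop :=
  ∀ (F : Series m k) (e : ℤ) (l : Fin m → ℕ) (G : Fin k → Ptn) (P : Ptn),
    {T : Multiset Triple | IsProper D T ∧
      MvPowerSeries.coeff P (cutJoinTerm x D T F e l G) ≠ 0}.Finite

/-! ### The generating functions -/

/-- The list `Δ_1, …, Δ_1, …, Δ_m, …, Δ_m, Γ_1, …, Γ_k, Γ` with `l_j` copies of `Δ_j`. -/
def profile {m k : ℕ} (D : Fin m → Ptn) (l : Fin m → ℕ) (G : Fin k → Ptn) (P : Ptn) :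
    List Ptn :=
  (List.ofFn fun j => List.replicate (l j) (D j)).flatten ++ List.ofFn G ++ [P]

/-- The part of the generating function that counts coverings of degree `n`:
`∑ z^{2h-2} U_g^{h,n}(Δ_1, …, Δ_m, …, Γ_1, …, Γ_k, Γ) ∏ u_j^{l_j} / l_j! ∏ p^{(i)}_{Γ_i} p_Γ`, over
all `h`, `l`, `Γ_1, …, Γ_k, Γ`. -/
def PhiDeg (g : ℕ) {m k : ℕ} (D : Fin m → Ptn) (n : ℕ) : Series m k :=
  fun e l G P => ∑ᶠ (h : ℤ) (_ : 2 * h - 2 = e),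
    U g h n (profile D l G P) / ∏ j, ((l j)! : ℂ)

/-- The generating function `Φ_g{z | (u_1, Δ_1), …, (u_m, Δ_m) | p^{(1)}, …, p^{(k)}, p}`, the sum
over all degrees `n ≥ 0`, coefficient by coefficient. -/
def Phi (g : ℕ) {m k : ℕ} (D : Fin m → Ptn) : Series m k :=
  fun e l G P => ∑ᶠ n : ℕ, MvPowerSeries.coeff P (PhiDeg g D n e l G)

/-- The part of the generating function in which the last ramification type is unshifted, that is,
`Γ` is a partition of the degree `n` of the covering. -/
def PhiUnshifted (g : ℕ) {m k : ℕ} (D : Fin m → Ptn) : Series m k :=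
  fun e l G P => MvPowerSeries.coeff P (PhiDeg g D (size P) e l G)

/-! ### The operator `∂ / ∂ p_Γ` is the iterated partial derivative -/

theorem partialP_zero (f : MvPowerSeries ℕ+ ℂ) : partialP 0 f = f := by
  ext P
  simp [partialP, MvPowerSeries.coeff_apply]

theorem partialP_add_single (Γ : Ptn) (a : ℕ+) (f : MvPowerSeries ℕ+ ℂ) :
    partialP (Γ + Finsupp.single a 1) f = MvPowerSeries.pderiv ℂ a (partialP Γ f) := by
  ext P
  have key : ∀ (Q R : Ptn) (s : Finset ℕ+), R.support ⊆ s →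
      (R.prod fun b k => (Q b + k).descFactorial k) =
        ∏ b ∈ s, (Q b + R b).descFactorial (R b) := fun Q R s hs =>
    Finsupp.prod_of_support_subset _ hs _ (by simp)
  have h1 := key P (Γ + Finsupp.single a 1) (insert a Γ.support) (by
    intro b hb
    by_cases hba : b = a
    · simp [hba]
    · have : ¬ a = b := fun h => hba h.symm
      simpa [Finsupp.single_apply, this, hba] using hb)
  have h2 := key (P + Finsupp.single a 1) Γ (insert a Γ.support) (Finset.subset_insert _ _)
  have h3 : ((Γ + Finsupp.single a 1).prod fun b k => (P b + k).descFactorial k) =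
      (Γ.prod fun b k => ((P + Finsupp.single a 1 : Ptn) b + k).descFactorial k) * (P a + 1) := by
    rw [h1, h2, ← Finset.mul_prod_erase _ _ (Finset.mem_insert_self a Γ.support),
      ← Finset.mul_prod_erase _ (fun b => ((P + Finsupp.single a 1 : Ptn) b + Γ b).descFactorial (Γ b))
        (Finset.mem_insert_self a Γ.support)]
    have h4 : ∀ b ∈ (insert a Γ.support).erase a,
        (P b + (Γ + Finsupp.single a 1 : Ptn) b).descFactorial ((Γ + Finsupp.single a 1 : Ptn) b) =
          ((P + Finsupp.single a 1 : Ptn) b + Γ b).descFactorial (Γ b) := by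
      intro b hb
      have : ¬ a = b := fun h => (Finset.mem_erase.mp hb).1 h.symm
      simp [this]
    rw [Finset.prod_congr rfl h4]
    have h5 : (P a + (Γ + Finsupp.single a 1 : Ptn) a).descFactorial ((Γ + Finsupp.single a 1 : Ptn) a) =
        (P a + 1) * ((P + Finsupp.single a 1 : Ptn) a + Γ a).descFactorial (Γ a) := by
      have e : P a + (Γ a + 1) - Γ a = P a + 1 := by omega
      have e' : P a + (Γ a + 1) = P a + 1 + Γ a := by omega
      simp only [Finsupp.add_apply, Finsupp.single_eq_same, Nat.descFactorial_succ, e]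
      rw [e']
    rw [h5]
    ring
  rw [MvPowerSeries.coeff_pderiv]
  simp only [partialP, MvPowerSeries.coeff_apply] at *
  rw [h3]
  have h6 : P + (Γ + Finsupp.single a 1) = P + Finsupp.single a 1 + Γ := by abel
  rw [h6]
  push_cast
  ring

end

end ShiftedHurwitz

open ShiftedHurwitz

namespace ShiftedHurwitz

noncomputable section

/-! ### Partitions as multisets of parts -/

/-! In degree n everything happens in the group algebra of S_n. The factor binom(n - |Δ| + m_1, m_1)
counts the ways to mark m_1(Δ) of the fixed points of a permutation of type [Δ, 1^{n-|Δ|}]. For the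
last ramification type, summing over the marks is the binomial expansion of (p_1 + 1)^{m_1}, so
Φ_{g,n} is a weighted sum, over the last monodromy s, of the shifted monomial of the full cycle type
of s (`PhiDeg_eq_degreeSeries`). With shift 0 instead of 1 only the part |Γ| = n survives, so one
proof with a shift c (`timeShift`) treats both kinds of variables.

The derivative in u_i inserts one more branch point, that is, multiplies by the central element
`classSum n (Δ i)` (`tailWeight_cons`). On monomials this sends the type of s to the sum over r of
the types of s * r, weighted by `shiftCount`. What remains is that W acts on monomials in the same
way (`W_permSeries`), which rests on `sum_shiftCount_mul_eq`.

To see this, cut the n points into the orbits of the group generated by s and r. An orbit on which r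
is trivial and unmarked is one cycle of s that is left alone; every other orbit is a connected
covering of the sphere with three branch points, counted by CU_0. The exponential formula
(`pairNumber_eq_decompSum`) sums over the collections T of such coverings and the type R of the
untouched cycles, with weight 1 / (|Aut T| z_R). Passing from all s of type Q to a fixed one
multiplies by z_Q, and z_Q / z_R is ‖Γ'‖ times the factor produced by the derivative in p_{Γ'}. The
powers of z follow from Riemann-Hurwitz.

The sum over n is controlled by a finite set of collections that depends on the output exponent and
not on the series (`finite_activeSet`), so W commutes with that sum (`W_coeffSum`). For g ≠ 1 the
Euler characteristic determines n, so the sum over n is finite. -/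

theorem size_add (D E : Ptn) : size (D + E) = size D + size E :=
  Finsupp.sum_add_index' (by simp) (by intros; ring)

theorem len_add (D E : Ptn) : len (D + E) = len D + len E :=
  Finsupp.sum_add_index' (by simp) (by intros; ring)

theorem partProd_add (D E : Ptn) : partProd (D + E) = partProd D * partProd E :=
  Finsupp.prod_add_index' (by simp) (by intros; ring)

@[simp] theorem size_zero : size 0 = 0 := Finsupp.sum_zero_index
@[simp] theorem len_zero : len 0 = 0 := Finsupp.sum_zero_index
@[simp] theorem partProd_zero : partProd 0 = 1 := Finsupp.prod_zero_index

@[simp] theorem size_single (a : ℕ+) (k : ℕ) : size (Finsupp.single a k) = a * k :=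
  Finsupp.sum_single_index (by simp)

@[simp] theorem len_single (a : ℕ+) (k : ℕ) : len (Finsupp.single a k) = k :=
  Finsupp.sum_single_index (by simp)

@[simp] theorem partProd_single (a : ℕ+) (k : ℕ) : partProd (Finsupp.single a k) = a ^ k :=
  Finsupp.prod_single_index (by simp)

theorem partProd_pos (D : Ptn) : 0 < partProd D :=
  Finset.prod_pos fun a _ => pow_pos a.pos _

theorem mul_apply_le_size (D : Ptn) (a : ℕ+) : (a : ℕ) * D a ≤ size D := by
  by_cases h : a ∈ D.support
  · exact Finset.single_le_sum (f := fun a : ℕ+ => (a : ℕ) * D a) (fun _ _ => Nat.zero_le _) h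
  · simp [Finsupp.notMem_support_iff.mp h]

theorem apply_le_size (D : Ptn) (a : ℕ+) : D a ≤ size D :=
  (Nat.le_mul_of_pos_left _ a.pos).trans (mul_apply_le_size D a)

theorem size_eq_zero {D : Ptn} : size D = 0 ↔ D = 0 := by
  refine ⟨fun h => ?_, fun h => by simp [h]⟩
  ext a
  simpa [h] using apply_le_size D a

theorem size_mono {D E : Ptn} (h : D ≤ E) : size D ≤ size E := by
  obtain ⟨F, rfl⟩ := exists_add_of_le h
  rw [size_add]; omega

theorem finite_size_le (N : ℕ) : {D : Ptn | size D ≤ N}.Finite := by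
  -- A part of `D` is at most N and occurs at most N times, so `D` lies below the partition with N
  -- copies of each of 1, …, N + 1.
  refine ((Finset.Iic (∑ a ∈ (Finset.range (N + 1)).image Nat.succPNat,
    Finsupp.single a N : Ptn)).finite_toSet).subset fun D hD => ?_
  have hD : size D ≤ N := hD
  simp only [Finset.coe_Iic, Set.mem_Iic]
  intro a
  rcases Nat.eq_zero_or_pos (D a) with h | h
  · simp [h]
  · have h1 := mul_apply_le_size D a
    have ha : (a : ℕ) ≤ N := (Nat.le_mul_of_pos_right _ h).trans (h1.trans hD)
    have hmem : a ∈ (Finset.range (N + 1)).image Nat.succPNat :=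
      Finset.mem_image.mpr ⟨a.natPred, by
        have := PNat.natPred_add_one a
        simp; omega, by simp⟩
    refine (apply_le_size D a).trans (hD.trans ?_)
    rw [Finsupp.finsetSum_apply]
    exact le_trans (by simp) (Finset.single_le_sum
      (f := fun b => (Finsupp.single b N : Ptn) a) (fun _ _ => Nat.zero_le _) hmem)

/-- The multiset of parts of a partition. -/
def toParts (D : Ptn) : Multiset ℕ := D.toMultiset.map (fun a : ℕ+ => (a : ℕ))

/-- The partition with a given multiset of parts; zeros are ignored. -/
def ofParts (m : Multiset ℕ) : Ptn :=
  (Multiset.toFinsupp m).comapDomain (fun a : ℕ+ => (a : ℕ)) PNat.coe_injective.injOn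

theorem ofParts_apply (m : Multiset ℕ) (a : ℕ+) : ofParts m a = m.count (a : ℕ) := by
  simp [ofParts]

theorem ofParts_add (m m' : Multiset ℕ) : ofParts (m + m') = ofParts m + ofParts m' := by
  ext a; simp [ofParts_apply]

theorem count_toParts (D : Ptn) (a : ℕ+) : (toParts D).count (a : ℕ) = D a := by
  rw [toParts, Multiset.count_map_eq_count' _ _ PNat.coe_injective, Finsupp.count_toMultiset]

theorem zero_notMem_toParts (D : Ptn) : 0 ∉ toParts D := by
  simp only [toParts, Multiset.mem_map, not_exists, not_and]
  intro a _ h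
  exact a.pos.ne' h

@[simp] theorem ofParts_toParts (D : Ptn) : ofParts (toParts D) = D := by
  ext a; rw [ofParts_apply, count_toParts]

theorem toParts_ofParts {m : Multiset ℕ} (h : 0 ∉ m) : toParts (ofParts m) = m := by
  ext a
  rcases Nat.eq_zero_or_pos a with rfl | ha
  · rw [Multiset.count_eq_zero_of_notMem h,
      Multiset.count_eq_zero_of_notMem (zero_notMem_toParts _)]
  · exact (count_toParts _ ⟨a, ha⟩).trans (ofParts_apply _ _)

theorem toParts_add (D E : Ptn) : toParts (D + E) = toParts D + toParts E := by
  simp [toParts]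

theorem toParts_single (a : ℕ+) (k : ℕ) :
    toParts (Finsupp.single a k) = Multiset.replicate k (a : ℕ) := by
  simp [toParts, Finsupp.toMultiset_single, Multiset.nsmul_singleton]

theorem sum_toParts (D : Ptn) : (toParts D).sum = size D := by
  induction D using Finsupp.induction_linear with
  | zero => simp [toParts]
  | add f g hf hg => rw [toParts_add, Multiset.sum_add, hf, hg, size_add]
  | single a k => simp [toParts_single, mul_comm]

theorem card_toParts (D : Ptn) : (toParts D).card = len D := by
  induction D using Finsupp.induction_linear with
  | zero => simp [toParts]
  | add f g hf hg => rw [toParts_add, Multiset.card_add, hf, hg, len_add]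
  | single a k => simp [toParts_single]

theorem shiftParts_eq (n : ℕ) (D : Ptn) :
    shiftParts n D = toParts (D + Finsupp.single 1 (n - size D)) := by
  rw [toParts_add, toParts_single]; rfl

/-! ### Cycle types as partitions -/

section PermType

variable {α β : Type*} [Fintype α] [DecidableEq α] [Fintype β] [DecidableEq β]

/-- The cycle type of a permutation, fixed points included. -/
def ptype (s : Equiv.Perm α) : Ptn := ofParts s.partition.parts

theorem toParts_ptype (s : Equiv.Perm α) : toParts (ptype s) = s.partition.parts :=
  toParts_ofParts fun h => (s.partition.parts_pos h).ne' rfl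

theorem size_ptype (s : Equiv.Perm α) : size (ptype s) = Fintype.card α := by
  rw [← sum_toParts, toParts_ptype, s.partition.parts_sum]

theorem len_ptype (s : Equiv.Perm α) : len (ptype s) = s.partition.parts.card := by
  rw [← card_toParts, toParts_ptype]

theorem parts_eq_toParts_iff {s : Equiv.Perm α} {D : Ptn} :
    s.partition.parts = toParts D ↔ ptype s = D := by
  rw [← toParts_ptype]
  exact ⟨fun h => by rw [← ofParts_toParts (ptype s), h, ofParts_toParts], fun h => by rw [h]⟩

theorem ptype_eq_of_cycleType {s : Equiv.Perm α} {t : Equiv.Perm β}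
    (hc : Fintype.card α = Fintype.card β) (h : s.cycleType = t.cycleType) :
    ptype s = ptype t := by
  rw [ptype, ptype, Equiv.Perm.parts_partition, Equiv.Perm.parts_partition,
    ← Equiv.Perm.sum_cycleType, ← Equiv.Perm.sum_cycleType, h, hc]

theorem ptype_eq_iff_isConj {s t : Equiv.Perm α} : ptype s = ptype t ↔ IsConj s t := by
  refine ⟨fun h => ?_, fun h => ptype_eq_of_cycleType rfl (Equiv.Perm.isConj_iff_cycleType_eq.mp h)⟩
  rw [Equiv.Perm.partition_eq_of_isConj, Nat.Partition.ext_iff, ← toParts_ptype, h, toParts_ptype]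

theorem ptype_conj (s t : Equiv.Perm α) : ptype (t * s * t⁻¹) = ptype s :=
  ptype_eq_of_cycleType rfl Equiv.Perm.cycleType_conj

theorem ptype_inv (s : Equiv.Perm α) : ptype s⁻¹ = ptype s :=
  ptype_eq_of_cycleType rfl (Equiv.Perm.cycleType_inv s)

theorem ptype_permCongr (e : α ≃ β) (s : Equiv.Perm α) : ptype (e.permCongr s) = ptype s := by
  refine ptype_eq_of_cycleType (Fintype.card_congr e).symm ?_
  -- `extendDomain` transports a permutation along a bijection onto a subtype; for the full subtype
  -- of `β` this is conjugation by `e`.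
  let f : α ≃ Subtype (fun _ : β => True) := e.trans (Equiv.Set.univ β).symm
  rw [← Equiv.Perm.cycleType_extendDomain f (g := s)]
  congr 1

theorem ptype_one : ptype (1 : Equiv.Perm α) = Finsupp.single 1 (Fintype.card α) := by
  rw [← parts_eq_toParts_iff, Equiv.Perm.parts_partition, toParts_single]
  simp

theorem ptype_subtypeCongr (p : α → Prop) [DecidablePred p] (s : Equiv.Perm {x // p x})
    (t : Equiv.Perm {x // ¬ p x}) :
    ptype (Equiv.Perm.subtypeCongr s t) = ptype s + ptype t := by
  have h1 : Equiv.Perm.subtypeCongr s t = Equiv.Perm.ofSubtype s * Equiv.Perm.ofSubtype t := by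
    ext x
    by_cases hx : p x
    · simp [Equiv.Perm.subtypeCongr.left_apply, hx, Equiv.Perm.ofSubtype_apply_of_mem,
        Equiv.Perm.ofSubtype_apply_of_not_mem]
    · have h3 : ¬ p (t ⟨x, hx⟩ : α) := (t ⟨x, hx⟩).2
      rw [Equiv.Perm.subtypeCongr.right_apply _ _ hx, Equiv.Perm.mul_apply,
        Equiv.Perm.ofSubtype_apply_of_mem t hx, Equiv.Perm.ofSubtype_apply_of_not_mem s h3]
  have h2 : Equiv.Perm.Disjoint (Equiv.Perm.ofSubtype s) (Equiv.Perm.ofSubtype t) := by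
    intro x
    by_cases hx : p x
    · right; exact Equiv.Perm.ofSubtype_apply_of_not_mem t (by simpa using hx)
    · left; exact Equiv.Perm.ofSubtype_apply_of_not_mem s hx
  have hc : (Equiv.Perm.subtypeCongr s t).cycleType = s.cycleType + t.cycleType := by
    rw [h1, h2.cycleType_mul, Equiv.Perm.cycleType_ofSubtype, Equiv.Perm.cycleType_ofSubtype]
  have hcard : Fintype.card α = Fintype.card {x // p x} + Fintype.card {x // ¬ p x} := by
    rw [Fintype.card_subtype_compl]
    have := Fintype.card_subtype_le p
    omega
  rw [ptype, ptype, ptype, ← ofParts_add]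
  congr 1
  rw [Equiv.Perm.parts_partition, Equiv.Perm.parts_partition, Equiv.Perm.parts_partition,
    ← Equiv.Perm.sum_cycleType, ← Equiv.Perm.sum_cycleType, ← Equiv.Perm.sum_cycleType, hc, hcard,
    Multiset.sum_add]
  have h4 := Equiv.Perm.sum_cycleType_le s
  have h5 := Equiv.Perm.sum_cycleType_le t
  rw [show Fintype.card {x // p x} + Fintype.card {x // ¬ p x} -
    (s.cycleType.sum + t.cycleType.sum) = (Fintype.card {x // p x} - s.cycleType.sum) +
      (Fintype.card {x // ¬ p x} - t.cycleType.sum) by omega, Multiset.replicate_add]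
  abel

/-- A cycle of length a has sign (-1)^(a+1); a fixed point adds 2 to the exponent, so counting fixed
points is harmless. -/
theorem sign_eq_neg_one_pow (s : Equiv.Perm α) :
    (Equiv.Perm.sign s : ℤ) = (-1) ^ (size (ptype s) + len (ptype s)) := by
  rw [Equiv.Perm.sign_of_cycleType, size_ptype, len_ptype, Equiv.Perm.parts_partition,
    Multiset.card_add, Multiset.card_replicate, Equiv.Perm.sum_cycleType]
  have := s.support.card_le_univ
  push_cast
  rw [neg_one_pow_eq_pow_mod_two, neg_one_pow_eq_pow_mod_two (n := Fintype.card α + _)]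
  congr 1
  omega

end PermType

/-! ### Monomials in shifted variables -/

section Mon

variable {R : Type*} [CommMonoid R]

/-- The monomial `∏_a x_a ^ m_a(Q)` in a family of elements of a commutative monoid. -/
def mon (x : ℕ+ → R) (Q : Ptn) : R := Q.prod fun a k => x a ^ k

@[simp] theorem mon_zero (x : ℕ+ → R) : mon x 0 = 1 := Finsupp.prod_zero_index

theorem mon_add (x : ℕ+ → R) (Q Q' : Ptn) : mon x (Q + Q') = mon x Q * mon x Q' :=
  Finsupp.prod_add_index' (by simp) (by intros; rw [pow_add])

@[simp] theorem mon_single (x : ℕ+ → R) (a : ℕ+) (k : ℕ) :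
    mon x (Finsupp.single a k) = x a ^ k :=
  Finsupp.prod_single_index (by simp)

theorem mon_congr {x y : ℕ+ → R} {Q : Ptn} (h : ∀ a ∈ Q.support, x a = y a) :
    mon x Q = mon y Q :=
  Finset.prod_congr rfl fun a ha => by simp only [h a ha]

end Mon

/-- The variables `x_a + δ_{a,1} c`. -/
def addShift {R : Type*} [CommSemiring R] (c : R) (x : ℕ+ → R) (a : ℕ+) : R :=
  x a + if a = 1 then c else 0

theorem erase_add_single_one (Q : Ptn) : Q.erase 1 + Finsupp.single 1 (Q 1) = Q := by
  rw [add_comm]; exact Finsupp.single_add_erase 1 Q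

/-- Expanding (x_1 + c)^{m_1} chooses which parts equal to 1 keep their variable. For c = 1 this
marks fixed points; for c = 0 it leaves the monomial alone. -/
theorem mon_addShift {R : Type*} [CommSemiring R] (c : R) (x : ℕ+ → R) (Q : Ptn) :
    mon (addShift c x) Q = ∑ j ∈ Finset.range (Q 1 + 1),
      ((Q 1).choose j * c ^ (Q 1 - j)) * mon x (Q.erase 1 + Finsupp.single 1 j) := by
  conv_lhs => rw [← erase_add_single_one Q, mon_add, mon_single]
  have h : mon (addShift c x) (Q.erase 1) = mon x (Q.erase 1) := mon_congr fun a ha => by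
    have : a ≠ 1 := by rintro rfl; simp at ha
    simp [addShift, this]
  rw [h, addShift, if_pos rfl, add_pow, Finset.mul_sum]
  refine Finset.sum_congr rfl fun j _ => ?_
  rw [mon_add, mon_single]
  ring

/-- The number of ways to choose a sub-collection of the parts equal to `1` of `Q` such that
together with all parts greater than `1` it forms `D`. -/
def shiftCount (Q D : Ptn) : ℕ := if Q.erase 1 = D.erase 1 then (Q 1).choose (D 1) else 0

theorem erase_add_single_eq_iff {Q D : Ptn} {j : ℕ} :
    Q.erase 1 + Finsupp.single 1 j = D ↔ Q.erase 1 = D.erase 1 ∧ j = D 1 := by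
  constructor
  · rintro rfl
    refine ⟨?_, by simp⟩
    ext a
    by_cases h : a = 1
    · simp [h]
    · simp [h, Finsupp.erase_ne]
  · rintro ⟨h, rfl⟩
    rw [h, erase_add_single_one]

theorem sum_choose_ite {R : Type*} [CommSemiring R] (c : R) (Q D : Ptn) :
    (∑ j ∈ Finset.range (Q 1 + 1), if Q.erase 1 + Finsupp.single 1 j = D then
      ((Q 1).choose j * c ^ (Q 1 - j) : R) else 0) = shiftCount Q D * c ^ (Q 1 - D 1) := by
  simp only [erase_add_single_eq_iff, shiftCount]
  by_cases h : Q.erase 1 = D.erase 1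
  · simp only [h, true_and, if_true, Finset.sum_ite_eq', Finset.mem_range]
    split_ifs with h1
    · rfl
    · rw [Nat.choose_eq_zero_of_lt (by omega)]; simp
  · simp [h]

/-- The marks on a permutation of n points reproduce the binomial factor of `U`. Truncation in `n -
size D` does no harm: if |D| > n, the padded partition is `D` itself, whose size is not n, and both
sides vanish. -/
theorem shiftCount_eq (n : ℕ) (Q D : Ptn) (hQ : size Q = n) :
    shiftCount Q D = if toParts Q = shiftParts n D then
      (n - size D + D 1).choose (D 1) else 0 := by
  rw [shiftParts_eq]
  have hinj : toParts Q = toParts (D + Finsupp.single 1 (n - size D)) ↔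
      Q = D + Finsupp.single 1 (n - size D) :=
    ⟨fun h => by rw [← ofParts_toParts Q, h, ofParts_toParts], fun h => by rw [h]⟩
  simp only [hinj]
  split_ifs with h
  · have h1 : Q.erase 1 = D.erase 1 ∧ Q 1 = D 1 + (n - size D) := by
      have := (erase_add_single_eq_iff (Q := D) (D := Q) (j := D 1 + (n - size D))).mp (by
        rw [Finsupp.single_add, ← add_assoc, erase_add_single_one]
        exact h.symm)
      exact ⟨this.1.symm, this.2.symm⟩
    rw [shiftCount, if_pos h1.1, h1.2, add_comm]
  · rw [shiftCount]
    split_ifs with h1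
    · refine Nat.choose_eq_zero_of_lt ?_
      by_contra hlt
      push Not at hlt
      have h2 : Q = D + Finsupp.single 1 (Q 1 - D 1) := by
        conv_lhs => rw [← erase_add_single_one Q, h1]
        conv_rhs => rw [← erase_add_single_one D]
        rw [add_assoc, ← Finsupp.single_add, Finsupp.add_apply, Finsupp.single_eq_same,
          Finsupp.erase_same, zero_add]
        congr 2
        omega
      apply h
      have h3 : n = size D + (Q 1 - D 1) := by
        rw [← hQ]
        conv_lhs => rw [h2, size_add, size_single]
        simp
      conv_lhs => rw [h2]
      congr 2
      omega
    · rfl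

theorem shiftCount_ne_zero {Q D : Ptn} (h : shiftCount Q D ≠ 0) :
    Q = D + Finsupp.single 1 (size Q - size D) ∧ size D ≤ size Q := by
  have h1 : Q.erase 1 = D.erase 1 ∧ D 1 ≤ Q 1 := by
    rw [shiftCount] at h
    split_ifs at h with h2
    · refine ⟨h2, ?_⟩
      by_contra hlt
      exact h (Nat.choose_eq_zero_of_lt (by omega))
    · exact absurd rfl h
  obtain ⟨j, hj⟩ := exists_add_of_le h1.2
  have h2 : Q = D + Finsupp.single 1 j := by
    rw [← erase_add_single_one Q, h1.1, hj, Finsupp.single_add, ← add_assoc,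
      erase_add_single_one]
  have h3 : size Q = size D + j := by rw [h2, size_add, size_single]; simp
  refine ⟨?_, by omega⟩
  rw [h3, Nat.add_sub_cancel_left]
  exact h2

/-! ### Monomials in the time variables -/

/-- The time variables `p_a + δ_{a,1} c`. -/
def timeShift (c : ℂ) : ℕ+ → MvPowerSeries ℕ+ ℂ :=
  addShift (MvPowerSeries.C c) timeVar

theorem timeShift_zero : timeShift 0 = timeVar := by
  funext a; simp [timeShift, addShift]

theorem timeShift_one : timeShift 1 = shiftedTimeVar := by
  funext a; simp [timeShift, addShift, shiftedTimeVar, timeVar]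

theorem monom_eq_mon (x : ℕ+ → MvPowerSeries ℕ+ ℂ) (Q : Ptn) : monom x Q = mon x Q := rfl

theorem mon_timeVar (Q : Ptn) : mon timeVar Q = MvPowerSeries.monomial Q (1 : ℂ) := by
  induction Q using Finsupp.induction_linear with
  | zero => simp
  | add f g hf hg => rw [mon_add, hf, hg, MvPowerSeries.monomial_mul_monomial, one_mul]
  | single a k => rw [mon_single, timeVar, MvPowerSeries.X_pow_eq]

theorem coeff_mon_timeShift (c : ℂ) (Q P : Ptn) :
    MvPowerSeries.coeff P (mon (timeShift c) Q) = shiftCount Q P * c ^ (Q 1 - P 1) := by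
  classical
  rw [timeShift, mon_addShift, map_sum, ← sum_choose_ite]
  refine Finset.sum_congr rfl fun j _ => ?_
  have h : (((Q 1).choose j : MvPowerSeries ℕ+ ℂ) * MvPowerSeries.C c ^ (Q 1 - j)) =
      MvPowerSeries.C ((Q 1).choose j * c ^ (Q 1 - j)) := by simp
  rw [h, mon_timeVar, MvPowerSeries.coeff_C_mul, MvPowerSeries.coeff_monomial]
  simp only [eq_comm (a := P), mul_ite, mul_one, mul_zero]

/-- The number of ways to differentiate `Γ` out of the monomial with exponents `Q`. -/
def descProd (Q Γ : Ptn) : ℕ := Γ.prod fun a k => (Q a).descFactorial k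

theorem descProd_eq_prod {Q Γ : Ptn} {s : Finset ℕ+} (h : Γ.support ⊆ s) :
    descProd Q Γ = ∏ a ∈ s, (Q a).descFactorial (Γ a) :=
  Finsupp.prod_of_support_subset _ h _ (by simp)

theorem descProd_add_single (Q Γ : Ptn) (a : ℕ+) :
    descProd Q (Γ + Finsupp.single a 1) = descProd Q Γ * (Q a - Γ a) := by
  rw [descProd_eq_prod (s := insert a Γ.support) (Γ := Γ + Finsupp.single a 1),
    descProd_eq_prod (Finset.subset_insert a Γ.support),
    ← Finset.mul_prod_erase _ _ (Finset.mem_insert_self a Γ.support),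
    ← Finset.mul_prod_erase _ (fun b => (Q b).descFactorial (Γ b))
      (Finset.mem_insert_self a Γ.support), Finset.prod_congr rfl (g := fun b =>
        (Q b).descFactorial (Γ b))]
  · simp only [Finsupp.add_apply, Finsupp.single_eq_same, Nat.descFactorial_succ]
    ring
  · intro b hb
    have : ¬ a = b := fun h => (Finset.mem_erase.mp hb).1 h.symm
    simp [this]
  · intro b hb
    by_cases hba : b = a
    · simp [hba]
    · have : ¬ a = b := fun h => hba h.symm
      simpa [Finsupp.single_apply, this, hba] using hb

theorem descProd_eq_zero {Q Γ : Ptn} (h : ¬ Γ ≤ Q) : descProd Q Γ = 0 := by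
  rw [Finsupp.le_def, not_forall] at h
  obtain ⟨a, ha⟩ := h
  refine Finset.prod_eq_zero (i := a) ?_ (Nat.descFactorial_eq_zero_iff_lt.mpr (by omega))
  rw [Finsupp.mem_support_iff]
  omega

/-- `∏_a m_a(Q)!`, the number of symmetries of the parts of `Q`. -/
def autPtn (Q : Ptn) : ℕ := Q.prod fun _ k => k !

@[simp] theorem autPtn_zero : autPtn 0 = 1 := Finsupp.prod_zero_index

theorem autPtn_pos (Q : Ptn) : 0 < autPtn Q := Finset.prod_pos fun _ _ => Nat.factorial_pos _

theorem autPtn_eq_prod {Q : Ptn} {s : Finset ℕ+} (h : Q.support ⊆ s) :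
    autPtn Q = ∏ a ∈ s, (Q a)! :=
  Finsupp.prod_of_support_subset _ h _ (by simp)

theorem autPtn_add (Q Γ : Ptn) : autPtn (Q + Γ) = descProd (Q + Γ) Γ * autPtn Q := by
  classical
  rw [autPtn_eq_prod (s := Q.support ∪ Γ.support) Finsupp.support_add,
    autPtn_eq_prod (s := Q.support ∪ Γ.support) Finset.subset_union_left,
    descProd_eq_prod (s := Q.support ∪ Γ.support) Finset.subset_union_right,
    ← Finset.prod_mul_distrib]
  refine Finset.prod_congr rfl fun a _ => ?_
  have := Nat.factorial_mul_descFactorial (n := (Q + Γ) a) (k := Γ a) (by simp)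
  rw [← this, mul_comm]
  simp

theorem autPtn_add_single (Q : Ptn) (a : ℕ+) :
    autPtn (Q + Finsupp.single a 1) = (Q a + 1) * autPtn Q := by
  rw [autPtn_add, descProd, Finsupp.prod_single_index (by simp)]
  simp

theorem pderiv_timeShift (c : ℂ) (a b : ℕ+) :
    MvPowerSeries.pderiv ℂ a (timeShift c b) = if a = b then 1 else 0 := by
  have h : MvPowerSeries.pderiv ℂ a (if b = 1 then MvPowerSeries.C c else 0) = 0 := by
    split_ifs
    · exact MvPowerSeries.pderiv_C
    · simp
  rw [timeShift, addShift, map_add, h, add_zero, timeVar]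
  split_ifs with hab
  · subst hab; exact MvPowerSeries.pderiv_X_self
  · exact MvPowerSeries.pderiv_X_of_ne fun h' => hab h'.symm

/-- The shift is a constant, so it is invisible to the derivative. If `Q a = 0`, the truncated
exponent is masked by the coefficient 0. -/
theorem pderiv_mon_timeShift (c : ℂ) (a : ℕ+) (Q : Ptn) :
    MvPowerSeries.pderiv ℂ a (mon (timeShift c) Q) =
      (Q a : ℂ) • mon (timeShift c) (Q - Finsupp.single a 1) := by
  have h0 : MvPowerSeries.pderiv ℂ a (mon (timeShift c) (Q.erase a)) = 0 := by
    have key : ∀ s : Finset ℕ+, a ∉ s →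
        MvPowerSeries.pderiv ℂ a (∏ b ∈ s, timeShift c b ^ Q.erase a b) = 0 := by
      intro s
      induction s using Finset.induction_on with
      | empty => simp
      | insert b s hb ih =>
        intro hs
        rw [Finset.mem_insert, not_or] at hs
        rw [Finset.prod_insert hb, Derivation.leibniz, ih hs.2, Derivation.leibniz_pow,
          pderiv_timeShift, if_neg hs.1]
        simp
    exact key _ (by simp)
  obtain ⟨E, n, hE, rfl⟩ : ∃ (E : Ptn) (n : ℕ), E.erase a = E ∧ Q = E + Finsupp.single a n :=
    ⟨Q.erase a, Q a, by simp, by rw [add_comm]; exact (Finsupp.single_add_erase a Q).symm⟩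
  have hEa : E a = 0 := by rw [← hE]; simp
  have h1 : (E + Finsupp.single a n).erase a = E := by simp [Finsupp.erase_add, hE]
  rw [h1] at h0
  have h2 : E + Finsupp.single a n - Finsupp.single a 1 = E + Finsupp.single a (n - 1) := by
    ext b
    by_cases hb : a = b
    · subst hb; simp [hEa]
    · simp [hb]
  rw [h2, mon_add, mon_add, mon_single, mon_single, Derivation.leibniz, h0, Derivation.leibniz_pow,
    pderiv_timeShift, if_pos rfl]
  simp only [Finsupp.add_apply, hEa, Finsupp.single_eq_same, zero_add, smul_eq_mul, mul_zero,
    add_zero, mul_one, nsmul_eq_mul, MvPowerSeries.smul_eq_C_mul, map_natCast]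
  ring

/-- Induction on the number of derivatives. Unless Γ ≤ Q, the truncated `Q - Γ` is harmless because
`descProd Q Γ` is 0. -/
theorem partialP_mon_timeShift (c : ℂ) (Q Γ : Ptn) :
    partialP Γ (mon (timeShift c) Q) = (descProd Q Γ : ℂ) • mon (timeShift c) (Q - Γ) := by
  induction h : len Γ generalizing Γ with
  | zero =>
    have : Γ = 0 := by
      ext a
      by_contra ha
      have : Γ a ≤ len Γ := Finset.single_le_sum (f := fun a => Γ a) (fun _ _ => Nat.zero_le _)
        (Finsupp.mem_support_iff.mpr ha)
      simp at ha
      omega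
    subst this
    rw [partialP_zero]
    simp [descProd]
  | succ k ih =>
    obtain ⟨a, ha⟩ : ∃ a, Γ a ≠ 0 := by
      by_contra hcon
      push Not at hcon
      have : Γ = 0 := by ext a; simp [hcon a]
      subst this
      simp at h
    obtain ⟨Γ', rfl⟩ : ∃ Γ', Γ = Γ' + Finsupp.single a 1 := by
      refine ⟨Γ - Finsupp.single a 1, (tsub_add_cancel_of_le ?_).symm⟩
      rw [Finsupp.single_le_iff]
      omega
    rw [len_add, len_single] at h
    rw [partialP_add_single, ih Γ' (by omega), Derivation.map_smul, pderiv_mon_timeShift, smul_smul,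
      descProd_add_single, tsub_add_eq_tsub_tsub]
    push_cast
    rfl

/-! ### Splitting pairs of permutations into their transitive components -/

section Components

variable {α β : Type*}

/-- The pair of permutations generates a transitive group on a non-empty set. -/
def IsTransPair (q : Equiv.Perm α × Equiv.Perm α) : Prop :=
  Nonempty α ∧ ∀ x y : α, ∃ w ∈ Subgroup.closure {q.1, q.2}, w x = y

theorem isTransPair_permCongr (e : α ≃ β) (q : Equiv.Perm α × Equiv.Perm α) :
    IsTransPair (e.permCongr q.1, e.permCongr q.2) ↔ IsTransPair q := by
  have h : Subgroup.closure {e.permCongr q.1, e.permCongr q.2} =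
      (Subgroup.closure {q.1, q.2}).map e.permCongrHom.toMonoidHom := by
    rw [MonoidHom.map_closure, Set.image_pair]
    rfl
  simp only [IsTransPair, h, Subgroup.mem_map]
  refine and_congr e.nonempty_congr.symm ⟨fun H x y => ?_, fun H x y => ?_⟩
  · obtain ⟨_, ⟨w, hw, rfl⟩, hxy⟩ := H (e x) (e y)
    refine ⟨w, hw, ?_⟩
    apply e.injective
    rw [← hxy]
    simp [Equiv.permCongrHom]
  · obtain ⟨w, hw, hxy⟩ := H (e.symm x) (e.symm y)
    refine ⟨_, ⟨w, hw, rfl⟩, ?_⟩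
    simp [Equiv.permCongrHom, hxy]

/-- The orbit of a point under the group generated by a pair of permutations. -/
def pairOrbit (q : Equiv.Perm α × Equiv.Perm α) (x : α) : Set α :=
  {y | ∃ w ∈ Subgroup.closure {q.1, q.2}, w x = y}

/-- Juxtaposition of two pairs of permutations. -/
def juxtapose (p : α → Prop) [DecidablePred p]
    (q : (Equiv.Perm {x // p x} × Equiv.Perm {x // p x}) ×
      (Equiv.Perm {x // ¬ p x} × Equiv.Perm {x // ¬ p x})) : Equiv.Perm α × Equiv.Perm α :=
  (Equiv.Perm.subtypeCongr q.1.1 q.2.1, Equiv.Perm.subtypeCongr q.1.2 q.2.2)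

theorem juxtapose_injective (p : α → Prop) [DecidablePred p] :
    Function.Injective (juxtapose p) := by
  rintro ⟨⟨a, b⟩, c, d⟩ ⟨⟨a', b'⟩, c', d'⟩ h
  have h1 := Equiv.Perm.subtypeCongrHom_injective p (a₁ := (a, c)) (a₂ := (a', c'))
    (congrArg Prod.fst h)
  have h2 := Equiv.Perm.subtypeCongrHom_injective p (a₁ := (b, d)) (a₂ := (b', d'))
    (congrArg Prod.snd h)
  simp_all

theorem closure_juxtapose_apply (p : α → Prop) [DecidablePred p]
    (q : (Equiv.Perm {x // p x} × Equiv.Perm {x // p x}) ×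
      (Equiv.Perm {x // ¬ p x} × Equiv.Perm {x // ¬ p x})) (x y : {x // p x}) :
    (y : α) ∈ pairOrbit (juxtapose p q) x ↔ ∃ w ∈ Subgroup.closure {q.1.1, q.1.2}, w x = y := by
  constructor
  · rintro ⟨w, hw, hxy⟩
    have : ∃ w' ∈ Subgroup.closure {q.1.1, q.1.2}, ∀ z : {x // p x}, w z = (w' z : α) := by
      clear hxy
      induction hw using Subgroup.closure_induction with
      | mem w hw =>
        rcases hw with rfl | rfl
        · exact ⟨q.1.1, Subgroup.subset_closure (by simp), fun z =>
            Equiv.Perm.subtypeCongr.left_apply_subtype _ _ z⟩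
        · exact ⟨q.1.2, Subgroup.subset_closure (by simp), fun z =>
            Equiv.Perm.subtypeCongr.left_apply_subtype _ _ z⟩
      | one => exact ⟨1, Subgroup.one_mem _, fun z => rfl⟩
      | mul a b _ _ ha hb =>
        obtain ⟨a', ha', ha⟩ := ha
        obtain ⟨b', hb', hb⟩ := hb
        exact ⟨a' * b', Subgroup.mul_mem _ ha' hb', fun z => by simp [ha, hb]⟩
      | inv a _ ha =>
        obtain ⟨a', ha', ha⟩ := ha
        refine ⟨a'⁻¹, Subgroup.inv_mem _ ha', fun z => ?_⟩
        rw [Equiv.Perm.inv_eq_iff_eq, ha]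
        simp
    obtain ⟨w', hw', h⟩ := this
    exact ⟨w', hw', Subtype.ext (by rw [← h, hxy])⟩
  · rintro ⟨w, hw, hxy⟩
    have : ∃ w' ∈ Subgroup.closure {(juxtapose p q).1, (juxtapose p q).2},
        ∀ z : {x // p x}, w' z = (w z : α) := by
      clear hxy
      induction hw using Subgroup.closure_induction with
      | mem w hw =>
        rcases hw with rfl | rfl
        · exact ⟨(juxtapose p q).1, Subgroup.subset_closure (by simp), fun z =>
            Equiv.Perm.subtypeCongr.left_apply_subtype _ _ z⟩
        · exact ⟨(juxtapose p q).2, Subgroup.subset_closure (by simp), fun z =>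
            Equiv.Perm.subtypeCongr.left_apply_subtype _ _ z⟩
      | one => exact ⟨1, Subgroup.one_mem _, fun z => rfl⟩
      | mul a b _ _ ha hb =>
        obtain ⟨a', ha', ha⟩ := ha
        obtain ⟨b', hb', hb⟩ := hb
        exact ⟨a' * b', Subgroup.mul_mem _ ha' hb', fun z => by simp [ha, hb]⟩
      | inv a _ ha =>
        obtain ⟨a', ha', ha⟩ := ha
        refine ⟨a'⁻¹, Subgroup.inv_mem _ ha', fun z => ?_⟩
        rw [Equiv.Perm.inv_eq_iff_eq, ha]
        simp
    obtain ⟨w', hw', h⟩ := this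
    exact ⟨w', hw', by rw [h, hxy]⟩

theorem pairOrbit_juxtapose_subset (p : α → Prop) [DecidablePred p]
    (q : (Equiv.Perm {x // p x} × Equiv.Perm {x // p x}) ×
      (Equiv.Perm {x // ¬ p x} × Equiv.Perm {x // ¬ p x})) (x : {x // p x}) :
    pairOrbit (juxtapose p q) x ⊆ {y | p y} := by
  rintro y ⟨w, hw, rfl⟩
  have : ∀ z, p (w z) ↔ p z := by
    induction hw using Subgroup.closure_induction with
    | mem w hw =>
      have key : ∀ (a : Equiv.Perm {x // p x}) (b : Equiv.Perm {x // ¬ p x}) (z : α),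
          p (Equiv.Perm.subtypeCongr a b z) ↔ p z := by
        intro a b z
        by_cases hz : p z
        · simp only [Equiv.Perm.subtypeCongr.left_apply _ _ hz, hz, iff_true]
          exact (a ⟨z, hz⟩).2
        · simp only [Equiv.Perm.subtypeCongr.right_apply _ _ hz, hz, iff_false]
          exact (b ⟨z, hz⟩).2
      rcases hw with rfl | rfl
      · exact key _ _
      · exact key _ _
    | one => simp
    | mul a b _ _ ha hb => intro z; rw [Equiv.Perm.mul_apply, ha, hb]
    | inv a _ ha => intro z; simpa using (ha (a⁻¹ z)).symm
  exact (this x).mpr x.2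

theorem pairOrbit_juxtapose_eq_iff (p : α → Prop) [DecidablePred p]
    (q : (Equiv.Perm {x // p x} × Equiv.Perm {x // p x}) ×
      (Equiv.Perm {x // ¬ p x} × Equiv.Perm {x // ¬ p x})) (x : {x // p x}) :
    pairOrbit (juxtapose p q) x = {y | p y} ↔ IsTransPair q.1 := by
  constructor
  · intro h
    refine ⟨⟨x⟩, fun y z => ?_⟩
    have hy : (y : α) ∈ pairOrbit (juxtapose p q) x := h ▸ y.2
    have hz : (z : α) ∈ pairOrbit (juxtapose p q) x := h ▸ z.2
    rw [closure_juxtapose_apply] at hy hz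
    obtain ⟨v, hv, rfl⟩ := hy
    obtain ⟨w, hw, rfl⟩ := hz
    exact ⟨w * v⁻¹, Subgroup.mul_mem _ hw (Subgroup.inv_mem _ hv), by simp⟩
  · intro h
    refine Set.Subset.antisymm (pairOrbit_juxtapose_subset p q x) fun y hy => ?_
    exact (closure_juxtapose_apply p q x ⟨y, hy⟩).mpr (h.2 x ⟨y, hy⟩)

/-- An orbit and its complement are stable under the group, so both generators restrict to the two
blocks. -/
theorem exists_juxtapose_of_pairOrbit_eq (p : α → Prop) [DecidablePred p]
    (q : Equiv.Perm α × Equiv.Perm α) (x : α) (h : pairOrbit q x = {y | p y}) :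
    ∃ r, juxtapose p r = q := by
  have key : ∀ w ∈ Subgroup.closure {q.1, q.2}, ∀ z, p z → p (w z) := by
    intro w hw z hz
    obtain ⟨v, hv, rfl⟩ : z ∈ pairOrbit q x := h ▸ hz
    have : (w * v) x ∈ pairOrbit q x := ⟨w * v, Subgroup.mul_mem _ hw hv, rfl⟩
    rw [h] at this
    exact this
  have key2 : ∀ w ∈ Subgroup.closure {q.1, q.2}, ∀ z, p (w z) ↔ p z := fun w hw z =>
    ⟨fun hz => by simpa using key w⁻¹ (Subgroup.inv_mem _ hw) _ hz, key w hw z⟩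
  have key3 : ∀ w ∈ Subgroup.closure {q.1, q.2}, ∃ a b, Equiv.Perm.subtypeCongr (p := p) a b = w := by
    intro w hw
    refine ⟨w.subtypePerm (key2 w hw), w.subtypePerm fun z => not_congr (key2 w hw z), ?_⟩
    ext z
    by_cases hz : p z
    · rw [Equiv.Perm.subtypeCongr.left_apply _ _ hz]; rfl
    · rw [Equiv.Perm.subtypeCongr.right_apply _ _ hz]; rfl
  obtain ⟨a, b, h1⟩ := key3 q.1 (Subgroup.subset_closure (by simp))
  obtain ⟨c, d, h2⟩ := key3 q.2 (Subgroup.subset_closure (by simp))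
  exact ⟨((a, c), (b, d)), Prod.ext h1 h2⟩

end Components

section Weights

variable {R : Type*} [CommSemiring R]

/-- The weight of a pair of permutations, by the cycle types of the two factors and the product. -/
def pairWeight {α : Type*} [Fintype α] [DecidableEq α] (y w v : ℕ+ → R)
    (q : Equiv.Perm α × Equiv.Perm α) : R :=
  mon y (ptype q.1) * mon w (ptype q.2) * mon v (ptype (q.1 * q.2))

/-- The total weight of all pairs of permutations. -/
def pairSum (α : Type*) [Fintype α] [DecidableEq α] (y w v : ℕ+ → R) : R :=
  ∑ q : Equiv.Perm α × Equiv.Perm α, pairWeight y w v q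

open Classical in
/-- The total weight of all transitive pairs of permutations. -/
def transPairSum (α : Type*) [Fintype α] [DecidableEq α] (y w v : ℕ+ → R) : R :=
  ∑ q : Equiv.Perm α × Equiv.Perm α with IsTransPair q, pairWeight y w v q

variable {α β : Type*} [Fintype α] [DecidableEq α] [Fintype β] [DecidableEq β] (y w v : ℕ+ → R)

theorem pairWeight_permCongr (e : α ≃ β) (q : Equiv.Perm α × Equiv.Perm α) :
    pairWeight y w v (e.permCongr q.1, e.permCongr q.2) = pairWeight y w v q := by
  have : e.permCongr q.1 * e.permCongr q.2 = e.permCongr (q.1 * q.2) := by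
    ext x; simp
  simp only [pairWeight, this, ptype_permCongr]

/-- Cycle types add under juxtaposition, and monomials turn these sums into products. This is why
pairs are weighted by monomials rather than counted type by type. -/
theorem pairWeight_juxtapose (p : α → Prop) [DecidablePred p]
    (q : (Equiv.Perm {x // p x} × Equiv.Perm {x // p x}) ×
      (Equiv.Perm {x // ¬ p x} × Equiv.Perm {x // ¬ p x})) :
    pairWeight y w v (juxtapose p q) = pairWeight y w v q.1 * pairWeight y w v q.2 := by
  have : (juxtapose p q).1 * (juxtapose p q).2 =
      Equiv.Perm.subtypeCongr (q.1.1 * q.1.2) (q.2.1 * q.2.2) :=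
    ((Equiv.Perm.subtypeCongrHom p).map_mul (q.1.1, q.2.1) (q.1.2, q.2.2)).symm
  simp only [pairWeight, this]
  simp only [juxtapose, ptype_subtypeCongr, mon_add]
  ring

theorem pairSum_congr (e : α ≃ β) : pairSum α y w v = pairSum β y w v :=
  Fintype.sum_equiv (e.permCongr.prodCongr e.permCongr) _ _
    fun q => (pairWeight_permCongr y w v e q).symm

theorem transPairSum_congr (e : α ≃ β) : transPairSum α y w v = transPairSum β y w v := by
  classical
  refine Finset.sum_equiv (e.permCongr.prodCongr e.permCongr) (fun q => ?_)
    fun q _ => (pairWeight_permCongr y w v e q).symm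
  simp only [Finset.mem_filter, Finset.mem_univ, true_and]
  exact (isTransPair_permCongr e q).symm

-- Once the orbit of `x` is prescribed to be `A`, what is left to choose is a transitive pair on `A`
-- and, independently, any pair on the complement.
open Classical in
theorem sum_pairOrbit_eq (A : Finset α) {x : α} (hx : x ∈ A) :
    ∑ q : Equiv.Perm α × Equiv.Perm α with pairOrbit q x = A, pairWeight y w v q =
      transPairSum {x // x ∈ A} y w v * pairSum {x // x ∉ A} y w v := by
  rw [transPairSum, pairSum, Finset.sum_mul_sum, ← Finset.sum_product']
  symm
  refine Finset.sum_bij (fun q _ => juxtapose (· ∈ A) q) ?_ ?_ ?_ ?_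
  · intro q hq
    simp only [Finset.mem_product, Finset.mem_filter, Finset.mem_univ, true_and, and_true] at hq ⊢
    exact (pairOrbit_juxtapose_eq_iff (· ∈ A) q ⟨x, hx⟩).mpr hq
  · intro q _ r _ h
    exact juxtapose_injective _ h
  · intro q hq
    simp only [Finset.mem_filter, Finset.mem_univ, true_and] at hq
    obtain ⟨r, rfl⟩ := exists_juxtapose_of_pairOrbit_eq (· ∈ A) q x hq
    refine ⟨r, ?_, rfl⟩
    simp only [Finset.mem_product, Finset.mem_filter, Finset.mem_univ, true_and, and_true]
    exact (pairOrbit_juxtapose_eq_iff (· ∈ A) r ⟨x, hx⟩).mp hq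
  · intro q _
    rw [pairWeight_juxtapose]
    congr!

/-- Mark a point and split by its orbit `A`; each `A` arises from `A.card` marked points. This
recursion plays the role of the exponential formula in its differentiated form, so only one orbit is
split off at a time. -/
theorem card_mul_pairSum_eq_sum_finset :
    (Fintype.card α : R) * pairSum α y w v =
      ∑ A : Finset α, (A.card : R) * (transPairSum {x // x ∈ A} y w v *
        pairSum {x // x ∉ A} y w v) := by
  classical
  have h1 : ∀ x : α, pairSum α y w v = ∑ A : Finset α with x ∈ A,
      transPairSum {x // x ∈ A} y w v * pairSum {x // x ∉ A} y w v := by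
    intro x
    rw [pairSum, ← Finset.sum_fiberwise_of_maps_to (s := Finset.univ)
      (t := Finset.univ.filter fun A : Finset α => x ∈ A)
      (g := fun q => (pairOrbit q x).toFinset)]
    · refine Finset.sum_congr rfl fun A hA => ?_
      rw [← sum_pairOrbit_eq y w v A (Finset.mem_filter.mp hA).2]
      refine Finset.sum_congr (Finset.filter_congr fun q _ => ?_) fun _ _ => rfl
      rw [← Finset.coe_inj, Set.coe_toFinset]
    · intro q _
      simp only [Finset.mem_filter, Finset.mem_univ, true_and, Set.mem_toFinset]
      exact ⟨1, Subgroup.one_mem _, rfl⟩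
  have h2 : (Fintype.card α : R) * pairSum α y w v = ∑ _x : α, pairSum α y w v := by
    simp
  rw [h2, Finset.sum_congr rfl fun x _ => h1 x]
  simp only [Finset.sum_filter]
  rw [Finset.sum_comm]
  refine Finset.sum_congr rfl fun A _ => ?_
  rw [← Finset.sum_filter, Finset.sum_const, nsmul_eq_mul]
  simp

theorem natCast_mul_pairSum_fin (n : ℕ) :
    (n : R) * pairSum (Fin n) y w v = ∑ N ∈ Finset.range (n + 1), (n.choose N : R) *
      ((N : R) * (transPairSum (Fin N) y w v * pairSum (Fin (n - N)) y w v)) := by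
  have h := card_mul_pairSum_eq_sum_finset (α := Fin n) y w v
  rw [Fintype.card_fin] at h
  rw [h]
  have h2 := Finset.sum_powerset_apply_card (fun N => (N : R) *
    (transPairSum (Fin N) y w v * pairSum (Fin (n - N)) y w v)) (x := (Finset.univ : Finset (Fin n)))
  simp only [Finset.powerset_univ, Finset.card_univ, Fintype.card_fin, nsmul_eq_mul] at h2
  rw [← h2]
  refine Finset.sum_congr rfl fun A _ => ?_
  rw [transPairSum_congr y w v (Fintype.equivFinOfCardEq (by simp) : {x // x ∈ A} ≃ Fin A.card),
    pairSum_congr y w v (Fintype.equivFinOfCardEq (by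
      rw [Fintype.card_subtype_compl]; simp) : {x // x ∉ A} ≃ Fin (n - A.card))]

end Weights

/-! ### Numbers of pairs of permutations with given cycle types -/

/-- The pairs of triples with a given sum. -/
def tripleAntidiag (τ : Triple) : Finset (Triple × Triple) :=
  (Finset.Iic τ).map ⟨fun t => (t, τ - t), fun _ _ h => congrArg Prod.fst h⟩

theorem mem_tripleAntidiag {τ : Triple} {p : Triple × Triple} :
    p ∈ tripleAntidiag τ ↔ p.1 + p.2 = τ := by
  simp only [tripleAntidiag, Finset.mem_map, Finset.mem_Iic]
  constructor
  · rintro ⟨t, ht, rfl⟩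
    exact add_tsub_cancel_of_le ht
  · rintro rfl
    exact ⟨p.1, le_self_add, Prod.ext rfl (add_tsub_cancel_left _ _)⟩

/-- The variables recording the first cycle type. -/
def typeVar₁ (a : ℕ+) : AddMonoidAlgebra ℂ Triple :=
  AddMonoidAlgebra.single (Finsupp.single a 1, 0, 0) 1

/-- The variables recording the second cycle type. -/
def typeVar₂ (a : ℕ+) : AddMonoidAlgebra ℂ Triple :=
  AddMonoidAlgebra.single (0, Finsupp.single a 1, 0) 1

/-- The variables recording the third cycle type. -/
def typeVar₃ (a : ℕ+) : AddMonoidAlgebra ℂ Triple :=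
  AddMonoidAlgebra.single (0, 0, Finsupp.single a 1) 1

theorem mon_typeVar₁ (Q : Ptn) : mon typeVar₁ Q = AddMonoidAlgebra.single (Q, 0, 0) 1 := by
  induction Q using Finsupp.induction_linear with
  | zero => simp; rfl
  | add f g hf hg => rw [mon_add, hf, hg, AddMonoidAlgebra.single_mul_single]; simp
  | single a k => rw [mon_single, typeVar₁, AddMonoidAlgebra.single_pow]; simp

theorem mon_typeVar₂ (Q : Ptn) : mon typeVar₂ Q = AddMonoidAlgebra.single (0, Q, 0) 1 := by
  induction Q using Finsupp.induction_linear with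
  | zero => simp; rfl
  | add f g hf hg => rw [mon_add, hf, hg, AddMonoidAlgebra.single_mul_single]; simp
  | single a k => rw [mon_single, typeVar₂, AddMonoidAlgebra.single_pow]; simp

theorem mon_typeVar₃ (Q : Ptn) : mon typeVar₃ Q = AddMonoidAlgebra.single (0, 0, Q) 1 := by
  induction Q using Finsupp.induction_linear with
  | zero => simp; rfl
  | add f g hf hg => rw [mon_add, hf, hg, AddMonoidAlgebra.single_mul_single]; simp
  | single a k => rw [mon_single, typeVar₃, AddMonoidAlgebra.single_pow]; simp

/-- The number of ways to turn a pair of permutations into one with cycle types `τ`, the second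
cycle type being shifted. -/
def pairCount {n : ℕ} (τ : Triple) (q : Equiv.Perm (Fin n) × Equiv.Perm (Fin n)) : ℕ :=
  if ptype q.1 = τ.1 ∧ ptype (q.1 * q.2) = τ.2.2 then shiftCount (ptype q.2) τ.2.1 else 0

/-- The shift by 1 in the second family of variables generates the marks on the fixed points of
`q.2`. -/
theorem coeff_pairWeight {n : ℕ} (τ : Triple) (q : Equiv.Perm (Fin n) × Equiv.Perm (Fin n)) :
    (pairWeight typeVar₁ (addShift 1 typeVar₂) typeVar₃ q).coeff τ = pairCount τ q := by
  obtain ⟨Q, D, P⟩ := τ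
  rw [pairWeight, mon_typeVar₁, mon_typeVar₃, mon_addShift, Finset.mul_sum, Finset.sum_mul,
    AddMonoidAlgebra.coeff_sum, Finsupp.finsetSum_apply]
  have h := sum_choose_ite (1 : ℂ) (ptype q.2) D
  simp only [one_pow, mul_one] at h
  simp only [one_pow, mul_one, mon_typeVar₂, ← nsmul_eq_mul, mul_smul_comm, smul_mul_assoc,
    AddMonoidAlgebra.single_mul_single, AddMonoidAlgebra.coeff_smul, Finsupp.smul_apply,
    AddMonoidAlgebra.coeff_single, Finsupp.single_apply, Prod.mk_add_mk, add_zero, zero_add,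
    Prod.mk.injEq, pairCount]
  by_cases h1 : ptype q.1 = Q
  · by_cases h2 : ptype (q.1 * q.2) = P
    · simp only [h1, h2, and_self, and_true, true_and, if_true, ← h]
      refine Finset.sum_congr rfl fun j _ => ?_
      split_ifs <;> simp
    · simp [h2]
  · simp [h1]

/-- The weighted number of pairs of permutations with cycle types `τ`. -/
def pairNumber (τ : Triple) : ℂ :=
  (∑ q : Equiv.Perm (Fin (size τ.1)) × Equiv.Perm (Fin (size τ.1)), (pairCount τ q : ℂ)) /
    ((size τ.1)! : ℂ)

open Classical in
/-- The weighted number of transitive pairs of permutations with cycle types `τ`. -/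
def transNumber (τ : Triple) : ℂ :=
  (∑ q : Equiv.Perm (Fin (size τ.1)) × Equiv.Perm (Fin (size τ.1)) with IsTransPair q,
    (pairCount τ q : ℂ)) / ((size τ.1)! : ℂ)

theorem pairCount_eq_zero {n : ℕ} {τ : Triple} (h : size τ.1 ≠ n)
    (q : Equiv.Perm (Fin n) × Equiv.Perm (Fin n)) : pairCount τ q = 0 := by
  refine if_neg fun h' => h ?_
  rw [← h'.1, size_ptype, Fintype.card_fin]

theorem coeff_pairSum (τ : Triple) (n : ℕ) :
    (pairSum (Fin n) typeVar₁ (addShift 1 typeVar₂) typeVar₃).coeff τ =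
      if size τ.1 = n then pairNumber τ * (n ! : ℂ) else 0 := by
  rw [pairSum, AddMonoidAlgebra.coeff_sum, Finsupp.finsetSum_apply]
  simp only [coeff_pairWeight]
  split_ifs with h
  · subst h
    rw [pairNumber, div_mul_cancel₀ _ (by exact_mod_cast (Nat.factorial_pos _).ne')]
  · exact Finset.sum_eq_zero fun q _ => by rw [pairCount_eq_zero h, Nat.cast_zero]

theorem coeff_transPairSum (τ : Triple) (n : ℕ) :
    (transPairSum (Fin n) typeVar₁ (addShift 1 typeVar₂) typeVar₃).coeff τ =
      if size τ.1 = n then transNumber τ * (n ! : ℂ) else 0 := by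
  rw [transPairSum, AddMonoidAlgebra.coeff_sum, Finsupp.finsetSum_apply]
  simp only [coeff_pairWeight]
  split_ifs with h
  · subst h
    rw [transNumber, div_mul_cancel₀ _ (by exact_mod_cast (Nat.factorial_pos _).ne')]
  · exact Finset.sum_eq_zero fun q _ => by rw [pairCount_eq_zero h, Nat.cast_zero]

/-- The coefficient of type τ in `natCast_mul_pairSum_fin`: the binomial coefficient becomes the
product of the two normalising factorials. -/
theorem size_mul_pairNumber (τ : Triple) :
    (size τ.1 : ℂ) * pairNumber τ =
      ∑ p ∈ tripleAntidiag τ, (size p.1.1 : ℂ) * (transNumber p.1 * pairNumber p.2) := by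
  have h := congrArg (fun x => AddMonoidAlgebra.coeff x τ)
    (natCast_mul_pairSum_fin typeVar₁ (addShift 1 typeVar₂) typeVar₃ (size τ.1))
  simp only [← nsmul_eq_mul, AddMonoidAlgebra.coeff_sum, Finsupp.finsetSum_apply,
    AddMonoidAlgebra.coeff_smul, Finsupp.smul_apply] at h
  simp only [AddMonoidAlgebra.coeff_mul_antidiag _ _ τ (tripleAntidiag τ) mem_tripleAntidiag,
    coeff_pairSum, coeff_transPairSum, if_true, nsmul_eq_mul] at h
  have hf : ∀ n : ℕ, (n ! : ℂ) ≠ 0 := fun n => by exact_mod_cast (Nat.factorial_pos n).ne'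
  apply mul_right_cancel₀ (hf (size τ.1))
  rw [mul_assoc, h, Finset.sum_mul]
  simp only [Finset.mul_sum]
  rw [Finset.sum_comm]
  refine Finset.sum_congr rfl fun p hp => ?_
  rw [mem_tripleAntidiag] at hp
  have hs : size τ.1 = size p.1.1 + size p.2.1 := by rw [← hp, ← size_add]; rfl
  -- The first cycle type of the split-off orbit determines its number of points.
  rw [Finset.sum_eq_single (size p.1.1)]
  · rw [if_pos rfl, if_pos (by omega)]
    have hc := Nat.choose_mul_factorial_mul_factorial (n := size τ.1) (k := size p.1.1) (by omega)
    have hc' : ((size τ.1).choose (size p.1.1) : ℂ) * ((size p.1.1)! : ℂ) *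
        ((size τ.1 - size p.1.1)! : ℂ) = ((size τ.1)! : ℂ) := by exact_mod_cast hc
    rw [← hc']
    ring
  · intro N _ hN
    rw [if_neg fun h => hN h.symm]
    ring
  · intro hN
    exact absurd (Finset.mem_range.mpr (by omega)) hN

/-! ### Transitive pairs with trivial second permutation -/

/-- Type 0 allows neither longer cycles nor marked fixed points: only the identity qualifies, in one
way. -/
theorem shiftCount_zero_right {α : Type*} [Fintype α] [DecidableEq α] (s : Equiv.Perm α) :
    shiftCount (ptype s) 0 = if s = 1 then 1 else 0 := by
  have h : (ptype s).erase 1 = 0 ↔ s = 1 := by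
    constructor
    · intro h
      have h1 : ptype s = ptype (1 : Equiv.Perm α) := by
        obtain ⟨k, hk⟩ : ∃ k, ptype s = Finsupp.single 1 k :=
          ⟨_, by rw [← erase_add_single_one (ptype s), h, zero_add]⟩
        have h3 := size_ptype s
        rw [hk, size_single] at h3
        rw [ptype_one, hk, ← h3]
        simp
      exact isConj_one_left.mp (ptype_eq_iff_isConj.mp h1)
    · rintro rfl
      rw [ptype_one, Finsupp.erase_single]
  simp [shiftCount, h]

theorem closure_pair_one {G : Type*} [Group G] (s : G) :
    Subgroup.closure {s, 1} = Subgroup.zpowers s := by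
  rw [Subgroup.zpowers_eq_closure]
  refine le_antisymm ?_ (Subgroup.closure_mono (by simp))
  rw [Subgroup.closure_le]
  rintro x (rfl | rfl)
  · exact Subgroup.subset_closure (by simp)
  · exact Subgroup.one_mem _

theorem isTransPair_one_iff (a : ℕ+) (s : Equiv.Perm (Fin a)) :
    IsTransPair (s, 1) ↔ ptype s = Finsupp.single a 1 := by
  have h0 : IsTransPair (s, 1) ↔ ∀ x y, s.SameCycle x y := by
    simp only [IsTransPair, closure_pair_one]
    refine ⟨fun h x y => ?_, fun h => ⟨⟨⟨0, a.pos⟩⟩, fun x y => ?_⟩⟩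
    · obtain ⟨_, ⟨k, rfl⟩, hk⟩ := h.2 x y
      exact ⟨k, hk⟩
    · obtain ⟨k, hk⟩ := h x y
      exact ⟨_, ⟨k, rfl⟩, hk⟩
  rw [h0]
  -- `IsCycle` and `cycleType` do not see fixed points, so a cycle of length 1 needs its own
  -- argument.
  by_cases ha : a = 1
  · subst ha
    have : Subsingleton (Fin ((1 : ℕ+) : ℕ)) := inferInstanceAs (Subsingleton (Fin 1))
    have hs : s = 1 := Subsingleton.elim _ _
    subst hs
    refine ⟨fun _ => ?_, fun _ x y => ?_⟩
    · rw [ptype_one, Fintype.card_fin]; rfl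
    · rw [Subsingleton.elim x y]
  · have ha2 : 2 ≤ (a : ℕ) := by
      have : (a : ℕ) ≠ 1 := fun h => ha (PNat.coe_injective h)
      have := a.pos
      omega
    have : Nontrivial (Fin a) := Fin.nontrivial_iff_two_le.mpr ha2
    constructor
    · intro h
      have hc : s.IsCycle := by
        obtain ⟨x, y, hxy⟩ := exists_pair_ne (Fin a)
        refine ⟨x, fun hx => hxy ?_, fun z _ => h x z⟩
        obtain ⟨k, hk⟩ := h x y
        rw [← hk, Equiv.Perm.zpow_apply_eq_self_of_apply_eq_self hx]
      have hsupp : s.support = Finset.univ := by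
        ext x
        simp only [Equiv.Perm.mem_support, Finset.mem_univ, iff_true]
        intro hx
        obtain ⟨y, hy⟩ := exists_ne x
        obtain ⟨k, hk⟩ := h x y
        exact hy (by rw [← hk, Equiv.Perm.zpow_apply_eq_self_of_apply_eq_self hx])
      rw [← parts_eq_toParts_iff, Equiv.Perm.parts_partition, hc.cycleType, hsupp, toParts_single]
      simp
    · intro h x y
      rw [← parts_eq_toParts_iff, toParts_single, Multiset.replicate_one] at h
      have hct : s.cycleType = {(a : ℕ)} := by
        rw [← Equiv.Perm.filter_parts_partition_eq_cycleType, h, Multiset.filter_singleton,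
          if_pos ha2]
      have hc : s.IsCycle := by rw [← Equiv.Perm.card_cycleType_eq_one, hct]; simp
      have hsupp : s.support = Finset.univ := by
        rw [← Finset.card_eq_iff_eq_univ, ← Equiv.Perm.sum_cycleType, hct]; simp
      have hm : ∀ z, s z ≠ z := fun z => by
        rw [← Equiv.Perm.mem_support, hsupp]; exact Finset.mem_univ z
      exact hc.sameCycle (hm x) (hm y)

theorem card_ptype_eq_single (a : ℕ+) :
    (Finset.univ.filter fun s : Equiv.Perm (Fin a) => ptype s = Finsupp.single a 1).card =
      ((a : ℕ) - 1)! := by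
  by_cases ha : a = 1
  · subst ha
    have : Subsingleton (Equiv.Perm (Fin ((1 : ℕ+) : ℕ))) :=
      inferInstanceAs (Subsingleton (Equiv.Perm (Fin 1)))
    rw [Finset.filter_true_of_mem, Finset.card_univ]
    · rw [Fintype.card_perm, Fintype.card_fin]; rfl
    · intro s _
      rw [Subsingleton.elim s 1, ptype_one, Fintype.card_fin]; rfl
  · have ha2 : 2 ≤ (a : ℕ) := by
      have : (a : ℕ) ≠ 1 := fun h => ha (PNat.coe_injective h)
      have := a.pos
      omega
    have h := Equiv.Perm.card_of_cycleType_singleton (α := Fin a) ha2 (by simp)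
    rw [Fintype.card_fin, Nat.choose_self, mul_one] at h
    rw [← h]
    congr 1
    ext s
    simp only [Finset.mem_filter, Finset.mem_univ, true_and]
    rw [← parts_eq_toParts_iff, toParts_single, Multiset.replicate_one]
    constructor
    · intro h
      rw [← Equiv.Perm.filter_parts_partition_eq_cycleType, h, Multiset.filter_singleton,
          if_pos ha2]
    · intro h
      rw [Equiv.Perm.parts_partition, ← Equiv.Perm.sum_cycleType, h]
      simp

/-- There are (a - 1)! full cycles among the a! permutations. This is the weight of an orbit on
which the second permutation does nothing. -/
theorem transNumber_single (a : ℕ+) :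
    transNumber (Finsupp.single a 1, 0, Finsupp.single a 1) = (a : ℂ)⁻¹ := by
  classical
  -- The degree `size (Finsupp.single a 1)` has to be replaced by `a` inside types, hence the
  -- general n.
  have key : ∀ n, n = (a : ℕ) →
      (∑ q : Equiv.Perm (Fin n) × Equiv.Perm (Fin n) with IsTransPair q,
        (pairCount (Finsupp.single a 1, 0, Finsupp.single a 1) q : ℂ)) / (n ! : ℂ) =
          (a : ℂ)⁻¹ := by
    rintro _ rfl
    have h1 : (∑ q : Equiv.Perm (Fin a) × Equiv.Perm (Fin a) with IsTransPair q,
        (pairCount (Finsupp.single a 1, 0, Finsupp.single a 1) q : ℂ)) = (((a : ℕ) - 1)! : ℕ) := by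
      rw [← card_ptype_eq_single, Finset.card_eq_sum_ones, Nat.cast_sum, Finset.sum_filter,
        Finset.sum_filter, Fintype.sum_prod_type]
      refine Finset.sum_congr rfl fun s _ => ?_
      rw [Finset.sum_eq_single 1]
      · rw [isTransPair_one_iff]
        simp [pairCount, shiftCount_zero_right]
      · intro t _ ht
        simp [pairCount, shiftCount_zero_right, ht]
      · simp
    rw [h1, ← Nat.mul_factorial_pred a.pos.ne']
    have h2 : ((((a : ℕ) - 1)! : ℕ) : ℂ) ≠ 0 := by exact_mod_cast (Nat.factorial_pos _).ne'
    have h3 : ((a : ℕ) : ℂ) ≠ 0 := by exact_mod_cast a.pos.ne'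
    push_cast
    field_simp
  exact key _ (by simp)

theorem exists_of_transNumber_ne_zero {t : Triple} (h : transNumber t ≠ 0) :
    ∃ q : Equiv.Perm (Fin (size t.1)) × Equiv.Perm (Fin (size t.1)), IsTransPair q ∧
      ptype q.1 = t.1 ∧ ptype (q.1 * q.2) = t.2.2 ∧ shiftCount (ptype q.2) t.2.1 ≠ 0 := by
  classical
  have h1 : (∑ q : Equiv.Perm (Fin (size t.1)) × Equiv.Perm (Fin (size t.1)) with IsTransPair q,
    (pairCount t q : ℂ)) ≠ 0 := fun h' => h (by rw [transNumber, h', zero_div])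
  obtain ⟨q, hq, hq'⟩ := Finset.exists_ne_zero_of_sum_ne_zero h1
  have h2 : pairCount t q ≠ 0 := by exact_mod_cast hq'
  rw [pairCount] at h2
  split_ifs at h2 with h3
  · exact ⟨q, (Finset.mem_filter.mp hq).2, h3.1, h3.2, h2⟩
  · exact absurd rfl h2

theorem size_pos_of_transNumber_ne_zero {t : Triple} (h : transNumber t ≠ 0) :
    1 ≤ size t.1 := by
  obtain ⟨q, ⟨⟨x⟩, _⟩, _⟩ := exists_of_transNumber_ne_zero h
  exact Nat.one_le_iff_ne_zero.mpr fun h0 => by rw [h0] at x; exact x.elim0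

theorem size_eq_of_transNumber_ne_zero {t : Triple} (h : transNumber t ≠ 0) :
    size t.2.2 = size t.1 := by
  obtain ⟨q, _, _, h1, _⟩ := exists_of_transNumber_ne_zero h
  rw [← h1, size_ptype, Fintype.card_fin]

/-- If the second permutation is trivial, the first one alone is transitive, hence a full cycle.
These are exactly the orbits that the condition |Δ^i| ≥ 1 excludes from W. -/
theorem eq_single_of_transNumber_ne_zero {t : Triple} (h : transNumber t ≠ 0)
    (h0 : t.2.1 = 0) :
    ∃ a : ℕ+, t = (Finsupp.single a 1, 0, Finsupp.single a 1) := by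
  have hpos := size_pos_of_transNumber_ne_zero h
  obtain ⟨⟨s, r⟩, hq, h1, h2, h3⟩ := exists_of_transNumber_ne_zero h
  rw [h0, shiftCount_zero_right] at h3
  have hr : r = 1 := by
    by_contra hr
    exact h3 (if_neg hr)
  subst hr
  have h4 := (isTransPair_one_iff ⟨size t.1, hpos⟩ s).mp hq
  rw [mul_one] at h2
  exact ⟨⟨size t.1, hpos⟩, Prod.ext (h1.symm.trans h4) (Prod.ext h0 (h2.symm.trans h4))⟩

/-! ### Finiteness of sets of collections -/

theorem finite_multiset_card_le {α : Type*} {S : Set α} (hS : S.Finite) (N : ℕ) :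
    {T : Multiset α | (∀ t ∈ T, t ∈ S) ∧ T.card ≤ N}.Finite := by
  classical
  refine ((N • hS.toFinset.val).powerset.toFinset.finite_toSet).subset fun T hT => ?_
  simp only [Finset.mem_coe, Multiset.mem_toFinset, Multiset.mem_powerset]
  rw [Multiset.le_iff_count]
  intro t
  rw [Multiset.count_nsmul]
  by_cases ht : t ∈ T
  · rw [Multiset.count_eq_one_of_mem hS.toFinset.nodup (by simpa using hT.1 t ht), mul_one]
    exact (Multiset.count_le_card t T).trans hT.2
  · rw [Multiset.count_eq_zero_of_notMem ht]
    exact Nat.zero_le _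

theorem inPart_eq (T : Multiset Triple) : inPart T = T.sum.1 :=
  (map_multiset_sum (AddMonoidHom.fst Ptn (Ptn × Ptn)) T).symm

theorem outPart_eq (T : Multiset Triple) : outPart T = T.sum.2.2 :=
  (map_multiset_sum ((AddMonoidHom.snd Ptn Ptn).comp (AddMonoidHom.snd Ptn (Ptn × Ptn))) T).symm

theorem sum_middle_eq (T : Multiset Triple) : (T.map fun t => t.2.1).sum = T.sum.2.1 :=
  (map_multiset_sum ((AddMonoidHom.fst Ptn Ptn).comp (AddMonoidHom.snd Ptn (Ptn × Ptn))) T).symm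

/-- The size, as an additive map. -/
def sizeHom : Ptn →+ ℕ where
  toFun := size
  map_zero' := size_zero
  map_add' := size_add

theorem size_sum_middle (T : Multiset Triple) :
    size T.sum.2.1 = (T.map fun t => size t.2.1).sum := by
  rw [← sum_middle_eq]
  exact (map_multiset_sum sizeHom _).trans (by rw [Multiset.map_map]; rfl)

theorem size_sum_fst (T : Multiset Triple) :
    size T.sum.1 = (T.map fun t => size t.1).sum := by
  rw [← inPart_eq]
  exact (map_multiset_sum sizeHom _).trans (by rw [Multiset.map_map]; rfl)

theorem card_le_size_middle {T : Multiset Triple} (h : ∀ t ∈ T, 1 ≤ size t.2.1) :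
    T.card ≤ size T.sum.2.1 := by
  rw [size_sum_middle]
  have := Multiset.card_nsmul_le_sum (s := T.map fun t => size t.2.1) (a := 1) (by
    intro x hx
    obtain ⟨t, ht, rfl⟩ := Multiset.mem_map.mp hx
    exact h t ht)
  simpa using this

/-- The condition |Δ^i| ≥ 1 bounds the number of triples by |Δ|; without it copies of the zero
triple could be added forever. -/
theorem finite_sum_le (τ : Triple) :
    {T : Multiset Triple | (∀ t ∈ T, 1 ≤ size t.2.1) ∧ T.sum ≤ τ}.Finite := by
  refine (finite_multiset_card_le (Finset.Iic τ).finite_toSet (size τ.2.1)).subset fun T hT => ?_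
  refine ⟨fun t ht => ?_, (card_le_size_middle hT.1).trans (size_mono hT.2.2.1)⟩
  simpa using (Multiset.single_le_sum (fun _ _ => bot_le) t ht).trans hT.2

/-! ### The sum over collections -/

theorem autCard_eq_prod {T : Multiset Triple} [inst : DecidableEq Triple] {s : Finset Triple}
    (h : T.toFinset ⊆ s) : autCard T = ∏ t ∈ s, (T.count t)! := by
  obtain rfl : inst = instDecidableEqProd := Subsingleton.elim _ _
  rw [autCard]
  refine Finset.prod_subset (M := ℕ) h fun t _ ht => ?_
  rw [Multiset.mem_toFinset] at ht
  rw [Multiset.count_eq_zero_of_notMem ht, Nat.factorial_zero]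

theorem autCard_cons [DecidableEq Triple] (t : Triple) (T : Multiset Triple) :
    autCard (t ::ₘ T) = (T.count t + 1) * autCard T := by
  have ht : t ∈ (t ::ₘ T).toFinset := by simp
  rw [autCard_eq_prod subset_rfl,
    autCard_eq_prod (T := T) (s := (t ::ₘ T).toFinset) (by simp),
    ← Finset.mul_prod_erase _ _ ht, ← Finset.mul_prod_erase _ (fun u => (T.count u)!) ht,
    Finset.prod_congr rfl (g := fun u => (T.count u)!)]
  · rw [Multiset.count_cons_self, Nat.factorial_succ, mul_assoc]
  · intro u hu
    rw [Multiset.count_cons_of_ne (Finset.ne_of_mem_erase hu)]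

theorem autCard_pos (T : Multiset Triple) : 0 < autCard T :=
  Finset.prod_pos fun _ _ => Nat.factorial_pos _

/-- The product of the numbers of transitive pairs over a collection of triples. -/
def collNumber (T : Multiset Triple) : ℂ := (autCard T : ℂ)⁻¹ * (T.map transNumber).prod

/-- Marking one of the equal copies of `t` and removing it cancels the top factor of the
corresponding factorial in |Aut T|. -/
theorem collNumber_cons [DecidableEq Triple] (t : Triple) (T : Multiset Triple) :
    ((t ::ₘ T).count t : ℂ) * collNumber (t ::ₘ T) = transNumber t * collNumber T := by
  have h1 : (autCard T : ℂ) ≠ 0 := by exact_mod_cast (autCard_pos T).ne'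
  have h2 : ((T.count t : ℂ) + 1) ≠ 0 := Nat.cast_add_one_ne_zero _
  rw [collNumber, collNumber, autCard_cons, Multiset.count_cons_self, Multiset.map_cons,
    Multiset.prod_cons]
  push_cast
  field_simp

/-- The triples that can have a transitive pair with non-trivial second cycle type. -/
def IsGood (t : Triple) : Prop := 1 ≤ size t.2.1 ∧ 1 ≤ size t.1 ∧ size t.2.2 = size t.1

/-- The triple of a collection of cycles that are not touched. -/
def diag (Q : Ptn) : Triple := (Q, 0, Q)

theorem diag_add (Q Q' : Ptn) : diag (Q + Q') = diag Q + diag Q' := by simp [diag]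

/-- The collections of triples, and of untouched cycles, with total type `τ`. -/
def decompSet (τ : Triple) : Set (Multiset Triple × Ptn) :=
  {x | (∀ t ∈ x.1, IsGood t) ∧ x.1.sum + diag x.2 = τ}

theorem finite_decompSet (τ : Triple) : (decompSet τ).Finite := by
  refine ((finite_sum_le τ).prod (Finset.Iic τ.1).finite_toSet).subset fun x hx => ?_
  refine ⟨⟨fun t ht => (hx.1 t ht).1, ?_⟩, ?_⟩
  · rw [← hx.2]; exact le_self_add
  · rw [← hx.2]; simp [diag]

/-- The collections of triples, and of untouched cycles, with total type `τ`. -/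
def decomp (τ : Triple) : Finset (Multiset Triple × Ptn) := (finite_decompSet τ).toFinset

theorem mem_decomp {τ : Triple} {x : Multiset Triple × Ptn} :
    x ∈ decomp τ ↔ (∀ t ∈ x.1, IsGood t) ∧ x.1.sum + diag x.2 = τ := by
  simp [decomp, decompSet]

/-- The order of the centralizer of a permutation of cycle type `Q`. -/
def zNumber (Q : Ptn) : ℂ := partProd Q * autPtn Q

theorem zNumber_ne_zero (Q : Ptn) : zNumber Q ≠ 0 := by
  have h1 := partProd_pos Q
  have h2 := autPtn_pos Q
  rw [zNumber]
  exact_mod_cast (Nat.mul_pos h1 h2).ne'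

theorem zNumber_add_single (Q : Ptn) (a : ℕ+) :
    zNumber (Q + Finsupp.single a 1) = a * (Q a + 1) * zNumber Q := by
  rw [zNumber, zNumber, partProd_add, autPtn_add_single, partProd_single]
  push_cast
  ring

/-- The weight of a collection of triples and of untouched cycles. -/
def decompWeight (x : Multiset Triple × Ptn) : ℂ := collNumber x.1 * (zNumber x.2)⁻¹

/-- The sum over all decompositions of the given type. -/
def decompSum (τ : Triple) : ℂ := ∑ x ∈ decomp τ, decompWeight x

theorem size_eq_of_mem_decomp [DecidableEq Triple] {τ : Triple} {x : Multiset Triple × Ptn}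
    (hx : x ∈ decomp τ) :
    (size τ.1 : ℂ) = ∑ t ∈ x.1.toFinset, (x.1.count t : ℂ) * size t.1 +
      ∑ a ∈ x.2.support, (a : ℂ) * x.2 a := by
  have h : size τ.1 = ∑ t ∈ x.1.toFinset, x.1.count t * size t.1 +
      ∑ a ∈ x.2.support, (a : ℕ) * x.2 a := by
    rw [← (mem_decomp.mp hx).2, Prod.fst_add, size_add, size_sum_fst,
      Finset.sum_multiset_map_count]
    simp only [smul_eq_mul]
    rfl
  rw [h]
  push_cast
  rfl

/-- The marked point lies in a triple, which is removed. Terms with vanishing `transNumber` are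
dropped on the way, because their triple need not satisfy `IsGood`. -/
theorem sum_marked_triple [DecidableEq Triple] (τ : Triple) :
    ∑ x ∈ decomp τ, ∑ t ∈ x.1.toFinset, (x.1.count t : ℂ) * size t.1 * decompWeight x =
      ∑ p ∈ tripleAntidiag τ with p.1.2.1 ≠ 0, ∑ x ∈ decomp p.2,
        (size p.1.1 : ℂ) * (transNumber p.1 * decompWeight x) := by
  rw [Finset.sum_sigma', Finset.sum_sigma']
  symm
  refine Finset.sum_bij_ne_zero (fun y _ _ => ⟨(y.1.1 ::ₘ y.2.1, y.2.2), y.1.1⟩) ?_ ?_ ?_ ?_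
  · rintro ⟨⟨t, t'⟩, T, Q⟩ hy hne
    simp only [Finset.mem_sigma, Finset.mem_filter, mem_tripleAntidiag, mem_decomp] at hy
    obtain ⟨⟨ht, h0⟩, hT, hs⟩ := hy
    have htn : transNumber t ≠ 0 := by
      intro h
      exact hne (by simp [h])
    simp only [Finset.mem_sigma, mem_decomp, Multiset.mem_cons, Multiset.sum_cons,
      Multiset.mem_toFinset, true_or, and_true]
    refine ⟨?_, by rw [← ht, ← hs, add_assoc]⟩
    rintro u (rfl | hu)
    · exact ⟨Nat.one_le_iff_ne_zero.mpr fun h => h0 (size_eq_zero.mp h),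
        size_pos_of_transNumber_ne_zero htn, size_eq_of_transNumber_ne_zero htn⟩
    · exact hT u hu
  · rintro ⟨⟨t, t'⟩, T, Q⟩ hy _ ⟨⟨u, u'⟩, T', Q'⟩ hy' _ h
    simp only [Finset.mem_sigma, Finset.mem_filter, mem_tripleAntidiag, mem_decomp] at hy hy'
    simp only [Sigma.mk.injEq, Prod.mk.injEq, heq_eq_eq] at h
    obtain ⟨⟨h1, rfl⟩, rfl⟩ := h
    rw [Multiset.cons_inj_right] at h1
    subst h1
    obtain rfl : t' = u' := by rw [← hy.2.2, ← hy'.2.2]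
    rfl
  · rintro ⟨⟨T, Q⟩, t⟩ hy hne
    simp only [Finset.mem_sigma, mem_decomp, Multiset.mem_toFinset] at hy
    obtain ⟨⟨hT, hs⟩, ht⟩ := hy
    have hc := Multiset.cons_erase ht
    refine ⟨⟨(t, (T.erase t).sum + diag Q), (T.erase t, Q)⟩, ?_, ?_, ?_⟩
    · simp only [Finset.mem_sigma, Finset.mem_filter, mem_tripleAntidiag, mem_decomp, and_true]
      refine ⟨⟨?_, ?_⟩, fun u hu => hT u (Multiset.mem_of_mem_erase hu)⟩
      · rw [← add_assoc, ← Multiset.sum_cons, hc, hs]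
      · intro h0
        have := (hT t ht).1
        rw [h0, size_zero] at this
        omega
    · intro h
      apply hne
      have h2 := collNumber_cons t (T.erase t)
      rw [hc] at h2
      simp only [decompWeight] at h ⊢
      rw [show (T.count t : ℂ) * size t.1 * (collNumber T * (zNumber Q)⁻¹) =
        size t.1 * ((T.count t * collNumber T) * (zNumber Q)⁻¹) by ring, h2]
      rw [← h]
      ring
    · simp only [hc]
  · rintro ⟨⟨t, t'⟩, T, Q⟩ _ _
    simp only [decompWeight]
    rw [show (((t ::ₘ T).count t : ℕ) : ℂ) * size t.1 * (collNumber (t ::ₘ T) * (zNumber Q)⁻¹) =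
        size t.1 * (((t ::ₘ T).count t * collNumber (t ::ₘ T)) * (zNumber Q)⁻¹) by ring,
        collNumber_cons]
    ring

/-- The marked point lies in an untouched cycle of length a. Removing the cycle turns a m_a / z_Q
into 1 / z of the rest, while on the other side the size a cancels the transitive number 1 / a. -/
theorem sum_marked_cycle (τ : Triple) :
    ∑ x ∈ decomp τ, ∑ a ∈ x.2.support, (a : ℂ) * x.2 a * decompWeight x =
      ∑ p ∈ tripleAntidiag τ with p.1.2.1 = 0, ∑ x ∈ decomp p.2,
        (size p.1.1 : ℂ) * (transNumber p.1 * decompWeight x) := by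
  rw [Finset.sum_sigma', Finset.sum_sigma']
  have hval : ∀ (T : Multiset Triple) (Q : Ptn) (a : ℕ+),
      (a : ℂ) * ((Q + Finsupp.single a 1 : Ptn) a : ℂ) *
        decompWeight (T, Q + Finsupp.single a 1) = decompWeight (T, Q) := by
    intro T Q a
    have h1 := zNumber_ne_zero Q
    have h2 : ((Q a : ℂ) + 1) ≠ 0 := Nat.cast_add_one_ne_zero _
    have h3 : ((a : ℕ) : ℂ) ≠ 0 := by exact_mod_cast a.pos.ne'
    simp only [decompWeight, zNumber_add_single, Finsupp.add_apply, Finsupp.single_eq_same]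
    push_cast
    field_simp
  refine Finset.sum_bij_ne_zero (fun y _ _ => ⟨(diag (Finsupp.single y.2 1),
    y.1.1.sum + diag (y.1.2 - Finsupp.single y.2 1)),
      (y.1.1, y.1.2 - Finsupp.single y.2 1)⟩) ?_ ?_ ?_ ?_
  · rintro ⟨⟨T, Q⟩, a⟩ hy hne
    simp only [Finset.mem_sigma, mem_decomp, Finsupp.mem_support_iff] at hy
    obtain ⟨⟨hT, hs⟩, ha⟩ := hy
    simp only [Finset.mem_sigma, Finset.mem_filter, mem_tripleAntidiag, mem_decomp, and_true]
    refine ⟨⟨?_, rfl⟩, hT⟩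
    rw [add_left_comm, ← diag_add, add_tsub_cancel_of_le, hs]
    rw [Finsupp.single_le_iff]
    omega
  · rintro ⟨⟨T, Q⟩, a⟩ hy _ ⟨⟨T', Q'⟩, a'⟩ hy' _ h
    simp only [Finset.mem_sigma, mem_decomp, Finsupp.mem_support_iff] at hy hy'
    simp only [Sigma.mk.injEq, Prod.mk.injEq, heq_eq_eq, diag] at h
    obtain ⟨⟨⟨h1, _⟩, _⟩, rfl, h2⟩ := h
    obtain rfl : a = a' := by
      have := DFunLike.congr_fun h1 a
      by_contra hne
      simp [Ne.symm hne] at this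
    obtain rfl : Q = Q' := by
      rw [← tsub_add_cancel_of_le (Finsupp.single_le_iff.mpr (Nat.one_le_iff_ne_zero.mpr hy.2)),
        h2, tsub_add_cancel_of_le (Finsupp.single_le_iff.mpr (Nat.one_le_iff_ne_zero.mpr hy'.2))]
    rfl
  · rintro ⟨⟨t, t'⟩, T, Q⟩ hy hne
    simp only [Finset.mem_sigma, Finset.mem_filter, mem_tripleAntidiag, mem_decomp] at hy
    obtain ⟨⟨ht, h0⟩, hT, hs⟩ := hy
    have htn : transNumber t ≠ 0 := by
      intro h
      exact hne (by simp [h])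
    obtain ⟨a, rfl⟩ := eq_single_of_transNumber_ne_zero htn h0
    refine ⟨⟨(T, Q + Finsupp.single a 1), a⟩, ?_, ?_, ?_⟩
    · simp only [Finset.mem_sigma, mem_decomp, Finsupp.mem_support_iff, Finsupp.add_apply,
        Finsupp.single_eq_same]
      refine ⟨⟨hT, ?_⟩, by omega⟩
      rw [diag_add, ← add_assoc, hs, ← ht, add_comm]
      rfl
    · simp only
      rw [hval]
      intro h
      exact hne (by simp [h])
    · simp only [add_tsub_cancel_right, hs]
      rfl
  · rintro ⟨⟨T, Q⟩, a⟩ hy _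
    simp only [Finset.mem_sigma, mem_decomp, Finsupp.mem_support_iff] at hy
    obtain ⟨Q, rfl⟩ : ∃ Q', Q = Q' + Finsupp.single a 1 :=
      ⟨Q - Finsupp.single a 1, (tsub_add_cancel_of_le
        (Finsupp.single_le_iff.mpr (Nat.one_le_iff_ne_zero.mpr hy.2))).symm⟩
    have h3 : ((a : ℕ) : ℂ) ≠ 0 := by exact_mod_cast a.pos.ne'
    simp only [hval, add_tsub_cancel_right]
    rw [show transNumber (diag (Finsupp.single a 1)) = (a : ℂ)⁻¹ from transNumber_single a]
    simp [diag, h3]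

/-- The same recursion as `size_mul_pairNumber`: the two kinds of marked orbit are those with zero
and with non-zero second type. -/
theorem size_mul_decompSum (τ : Triple) :
    (size τ.1 : ℂ) * decompSum τ =
      ∑ p ∈ tripleAntidiag τ, (size p.1.1 : ℂ) * (transNumber p.1 * decompSum p.2) := by
  classical
  have h1 : (size τ.1 : ℂ) * decompSum τ =
      ∑ x ∈ decomp τ, ∑ t ∈ x.1.toFinset, (x.1.count t : ℂ) * size t.1 * decompWeight x +
      ∑ x ∈ decomp τ, ∑ a ∈ x.2.support, (a : ℂ) * x.2 a * decompWeight x := by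
    rw [decompSum, Finset.mul_sum, ← Finset.sum_add_distrib]
    refine Finset.sum_congr rfl fun x hx => ?_
    rw [size_eq_of_mem_decomp hx, add_mul, Finset.sum_mul, Finset.sum_mul]
  rw [h1, sum_marked_triple, sum_marked_cycle, add_comm,
    Finset.sum_filter_add_sum_filter_not (tripleAntidiag τ) (fun p => p.1.2.1 = 0)]
  refine Finset.sum_congr rfl fun p _ => ?_
  rw [decompSum, Finset.mul_sum, Finset.mul_sum]

/-- The exponential formula. Both sides obey the marked-point recursion, and it strictly lowers the
degree because an orbit is non-empty. -/
theorem pairNumber_eq_decompSum (τ : Triple) : pairNumber τ = decompSum τ := by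
  induction hn : size τ.1 using Nat.strong_induction_on generalizing τ with
  | _ n ih =>
    subst hn
    -- In degree 0 the recursion only says 0 = 0, so both sides are computed directly.
    by_cases h0 : size τ.1 = 0
    · obtain ⟨Q, D, P⟩ := τ
      obtain rfl : Q = 0 := size_eq_zero.mp h0
      have hempty : IsEmpty (Fin (size (0 : Ptn))) := by rw [size_zero]; infer_instance
      have hp : ∀ s : Equiv.Perm (Fin (size (0 : Ptn))), ptype s = 0 := fun s =>
        size_eq_zero.mp (by rw [size_ptype, Fintype.card_fin, size_zero])
      have hsc : shiftCount 0 D = if D = 0 then 1 else 0 := by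
        split_ifs with hD
        · subst hD; simp [shiftCount]
        · by_contra hne
          have := (shiftCount_ne_zero hne).2
          rw [size_zero, Nat.le_zero, size_eq_zero] at this
          exact hD this
      have hl : pairNumber (0, D, P) = if D = 0 ∧ P = 0 then 1 else 0 := by
        simp only [pairNumber, pairCount, hp, hsc]
        by_cases hP : P = 0
        · simp [hP]
        · have : ¬ 0 = P := fun h => hP h.symm
          simp [hP, this]
      rw [hl, decompSum]
      have hx : ∀ x ∈ decomp (0, D, P), x = (0, 0) := by
        rintro ⟨T, Q⟩ hx
        rw [mem_decomp] at hx
        have h1 : T.sum.1 + Q = 0 := congrArg Prod.fst hx.2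
        rw [add_eq_zero] at h1
        have h2 := size_sum_fst T
        rw [h1.1, size_zero, eq_comm, Multiset.sum_eq_zero_iff] at h2
        refine Prod.ext (Multiset.eq_zero_of_forall_notMem fun t ht => ?_) h1.2
        have h3 := h2 _ (Multiset.mem_map_of_mem _ ht)
        have h4 := (hx.1 t ht).2.1
        omega
      split_ifs with h
      · obtain ⟨rfl, rfl⟩ := h
        have : decomp (0, 0, 0) = {(0, 0)} := by
          ext x
          refine ⟨fun h => by simpa using hx x h, fun h => ?_⟩
          rw [Finset.mem_singleton] at h
          subst h
          rw [mem_decomp]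
          simp [diag]
        rw [this, Finset.sum_singleton]
        simp [decompWeight, collNumber, autCard, zNumber]
      · symm
        refine Finset.sum_eq_zero fun x hx' => absurd ?_ h
        have h1 := hx x hx'
        subst h1
        have := (mem_decomp.mp hx').2
        simp only [diag, Multiset.sum_zero, zero_add, Prod.mk.injEq, true_and] at this
        exact ⟨this.1.symm, this.2.symm⟩
    · have hne : (size τ.1 : ℂ) ≠ 0 := by exact_mod_cast h0
      apply mul_left_cancel₀ hne
      rw [size_mul_pairNumber, size_mul_decompSum]
      refine Finset.sum_congr rfl fun p hp => ?_
      rw [mem_tripleAntidiag] at hp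
      by_cases ht : transNumber p.1 = 0
      · simp [ht]
      · have h1 := size_pos_of_transNumber_ne_zero ht
        have hs : size τ.1 = size p.1.1 + size p.2.1 := by rw [← hp, ← size_add]; rfl
        rw [ih (size p.2.1) (by omega) p.2 rfl]

/-! ### Coverings of the sphere with three branch points -/

/-- Monodromy data of a covering of the sphere with three branch points are given by the first two
permutations. -/
def monodromyThreeEquiv (n : ℕ) :
    Equiv.Perm (Fin n) × Equiv.Perm (Fin n) ≃ Monodromy 0 n 3 where
  toFun q := ⟨Fin.elim0, Fin.elim0, ![q.1, q.2, (q.1 * q.2)⁻¹], by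
    simp [List.ofFn_succ]⟩
  invFun M := (M.s 0, M.s 1)
  left_inv q := rfl
  right_inv M := by
    obtain ⟨a, b, s, rel⟩ := M
    have h : s 2 = (s 0 * s 1)⁻¹ := by
      have : s 0 * s 1 * s 2 = 1 := by simpa [List.ofFn_succ, mul_assoc] using rel
      exact eq_inv_of_mul_eq_one_right this
    simp only [Monodromy.mk.injEq]
    refine ⟨Subsingleton.elim _ _, Subsingleton.elim _ _, ?_⟩
    ext i : 1
    fin_cases i
    · rfl
    · rfl
    · exact h.symm

theorem parts_card_of_eq_shiftParts {n : ℕ} {s : Equiv.Perm (Fin n)} {D : Ptn}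
    (h : s.partition.parts = shiftParts n D) :
    size D ≤ n ∧ (s.partition.parts.card : ℤ) = len D + (n - size D) := by
  have h1 : s.partition.parts.sum = n := by rw [s.partition.parts_sum, Fintype.card_fin]
  rw [h, shiftParts_eq, sum_toParts, size_add, size_single] at h1
  have h2 : size D ≤ n := by omega
  refine ⟨h2, ?_⟩
  rw [h, shiftParts_eq, card_toParts, len_add, len_single]
  push_cast [h2]
  ring

theorem isTransPair_iff_isConnected {n : ℕ} (q : Equiv.Perm (Fin n) × Equiv.Perm (Fin n)) :
    (monodromyThreeEquiv n q).IsConnected ↔ IsTransPair q := by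
  have hcl : Subgroup.closure (Set.range (monodromyThreeEquiv n q).a ∪
      Set.range (monodromyThreeEquiv n q).b ∪ Set.range (monodromyThreeEquiv n q).s) =
      Subgroup.closure {q.1, q.2} := by
    have h1 : Set.range (monodromyThreeEquiv n q).a = ∅ := Set.range_eq_empty _
    have h2 : Set.range (monodromyThreeEquiv n q).b = ∅ := Set.range_eq_empty _
    rw [h1, h2, Set.empty_union, Set.empty_union]
    apply le_antisymm
    · rw [Subgroup.closure_le]
      rintro _ ⟨i, rfl⟩
      have hq1 : q.1 ∈ Subgroup.closure {q.1, q.2} := Subgroup.subset_closure (by simp)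
      have hq2 : q.2 ∈ Subgroup.closure {q.1, q.2} := Subgroup.subset_closure (by simp)
      fin_cases i
      · exact hq1
      · exact hq2
      · exact Subgroup.inv_mem _ (Subgroup.mul_mem _ hq1 hq2)
    · refine Subgroup.closure_mono ?_
      rintro x (rfl | rfl)
      · exact ⟨0, rfl⟩
      · exact ⟨1, rfl⟩
  rw [Monodromy.IsConnected, IsTransPair, hcl, Fin.pos_iff_nonempty]

/-- Multiplicativity of the sign. It makes the integer division in `genusPlus` exact whenever a pair
of the given types exists. -/
theorem size_add_len_even {n : ℕ} (q : Equiv.Perm (Fin n) × Equiv.Perm (Fin n)) :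
    Even (n + len (ptype q.1) + len (ptype q.2) + len (ptype (q.1 * q.2))) := by
  have h : (Equiv.Perm.sign (q.1 * q.2) : ℤ) = Equiv.Perm.sign q.1 * Equiv.Perm.sign q.2 := by
    rw [Equiv.Perm.sign_mul]; rfl
  simp only [sign_eq_neg_one_pow, size_ptype, Fintype.card_fin] at h
  rw [← pow_add] at h
  by_contra hodd
  rw [Nat.not_even_iff_odd] at hodd
  have h2 : ((-1 : ℤ)) ^ (n + len (ptype (q.1 * q.2)) + (n + len (ptype q.1) + (n + len (ptype q.2)))) =
      -1 := by
    apply Odd.neg_one_pow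
    have : n + len (ptype (q.1 * q.2)) + (n + len (ptype q.1) + (n + len (ptype q.2))) =
      2 * n + (n + len (ptype q.1) + len (ptype q.2) + len (ptype (q.1 * q.2))) := by ring
    rw [this]
    exact (even_two_mul n).add_odd hodd
  rw [pow_add, h, ← pow_add] at h2
  rw [Even.neg_one_pow ⟨_, rfl⟩] at h2
  norm_num at h2

/-- By Riemann-Hurwitz the types force the Euler characteristic l(Γ') + l(Δ) + l(Γ) - |Δ|, which is
2 - 2h⁺, so the genus condition is automatic. -/
theorem isCover_iff (t : Triple) (hs : size t.2.2 = size t.1)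
    (q : Equiv.Perm (Fin (size t.1)) × Equiv.Perm (Fin (size t.1))) :
    Monodromy.IsCover (genusPlus t) [t.1, t.2.1, t.2.2] (monodromyThreeEquiv _ q) ↔
      (ptype q.1 = t.1 ∧ ptype (q.1 * q.2) = t.2.2) ∧
        toParts (ptype q.2) = shiftParts (size t.1) t.2.1 := by
  obtain ⟨A, B, C⟩ := t
  simp only at hs q ⊢
  have hA : ∀ s : Equiv.Perm (Fin (size A)), s.partition.parts = shiftParts (size A) A ↔
      ptype s = A := fun s => by
    rw [shiftParts_eq, parts_eq_toParts_iff]; simp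
  have hC : ∀ s : Equiv.Perm (Fin (size A)), s.partition.parts = shiftParts (size A) C ↔
      ptype s = C := fun s => by
    rw [shiftParts_eq, parts_eq_toParts_iff, hs]; simp
  have htypes : (∀ i : Fin 3, ((monodromyThreeEquiv _ q).s i).partition.parts =
      shiftParts (size A) ([A, B, C].get i)) ↔ (ptype q.1 = A ∧ ptype (q.1 * q.2) = C) ∧
        toParts (ptype q.2) = shiftParts (size A) B := by
    rw [Fin.forall_fin_succ, Fin.forall_fin_succ, Fin.forall_fin_one]
    have h2 : (q.1 * q.2)⁻¹.partition.parts = shiftParts (size A) C ↔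
      ptype (q.1 * q.2) = C := by rw [hC, ptype_inv]
    rw [toParts_ptype, and_assoc, and_comm (a := ptype (q.1 * q.2) = C), ← hA q.1, ← h2]
    rfl
  rw [← htypes]
  refine ⟨fun h => h.2, fun h => ⟨?_, h⟩⟩
  obtain ⟨⟨h1, h2⟩, h3⟩ := htypes.mp h
  have hev := size_add_len_even q
  rw [toParts_ptype] at h3
  have h4 := parts_card_of_eq_shiftParts h3
  have h6 : (monodromyThreeEquiv _ q).eulerChar = (size A : ℤ) * (2 - 2 * ((0 : ℕ) : ℤ) - ((3 : ℕ) : ℤ)) +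
      (q.1.partition.parts.card + q.2.partition.parts.card +
        (q.1 * q.2)⁻¹.partition.parts.card) := by
    rw [Monodromy.eulerChar, Fin.sum_univ_three]; rfl
  have h5 : (genusPlus (A, B, C)) = ((size B : ℤ) - len B - len A - len C + 2) / 2 := rfl
  refine h6.trans ?_
  rw [h4.2, h5, ← len_ptype, ← len_ptype, ptype_inv, h1, h2]
  rw [h1, h2, len_ptype] at hev
  obtain ⟨r, hr⟩ := hev
  have h7 := h4.2
  push_cast
  omega

/-- The first and third types have full size n, so their binomial factors are 1 and only the middle
one carries marks. -/
theorem CU_zero_eq_transNumber (t : Triple) (hs : size t.2.2 = size t.1) :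
    CU 0 (genusPlus t) (size t.1) [t.1, t.2.1, t.2.2] = transNumber t := by
  classical
  have hf : shiftFactor (size t.1) [t.1, t.2.1, t.2.2] =
      (size t.1 - size t.2.1 + t.2.1 1).choose (t.2.1 1) := by
    simp [shiftFactor, hs]
  have hcard : Nat.card {M : Monodromy 0 (size t.1) 3 //
      Monodromy.IsCover (genusPlus t) [t.1, t.2.1, t.2.2] M ∧ M.IsConnected} =
      (Finset.univ.filter fun q : Equiv.Perm (Fin (size t.1)) × Equiv.Perm (Fin (size t.1)) =>
        IsTransPair q ∧ (ptype q.1 = t.1 ∧ ptype (q.1 * q.2) = t.2.2) ∧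
        toParts (ptype q.2) = shiftParts (size t.1) t.2.1).card := by
    rw [← Nat.card_congr ((monodromyThreeEquiv _).subtypeEquiv (p := fun q =>
      IsTransPair q ∧ (ptype q.1 = t.1 ∧ ptype (q.1 * q.2) = t.2.2) ∧
        toParts (ptype q.2) = shiftParts (size t.1) t.2.1) fun q => ?_),
      Nat.card_eq_fintype_card, Fintype.card_subtype]
    rw [isCover_iff t hs, isTransPair_iff_isConnected, and_comm]
  have hcard' : connHurwitz 0 (genusPlus t) (size t.1) [t.1, t.2.1, t.2.2] = _ :=
    congrArg (fun x : ℕ => (x : ℂ) / ((size t.1)! : ℂ)) hcard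
  rw [CU, hcard', hf, transNumber, ← mul_div_assoc]
  congr 1
  rw [Finset.card_eq_sum_ones, Finset.sum_filter, Finset.sum_filter, Nat.cast_sum, Finset.mul_sum]
  refine Finset.sum_congr rfl fun q _ => ?_
  rw [pairCount, shiftCount_eq (size t.1) _ _ (by rw [size_ptype, Fintype.card_fin])]
  by_cases h1 : IsTransPair q <;>
    by_cases h2 : (ptype q.1 = t.1 ∧ ptype (q.1 * q.2) = t.2.2) <;>
    by_cases h3 : toParts (ptype q.2) = shiftParts (size t.1) t.2.1 <;>
    simp [h1, h2, h3]

theorem tripleCoeff_eq (t : Triple) : tripleCoeff t = partProd t.1 * transNumber t := by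
  rw [tripleCoeff]
  split_ifs with h
  · rw [CU_zero_eq_transNumber t h]
  · have : transNumber t = 0 := by
      by_contra h'
      exact h (size_eq_of_transNumber_ne_zero h')
    rw [this, mul_zero]

theorem collCoeff_eq (T : Multiset Triple) :
    collCoeff T = partProd (inPart T) * collNumber T := by
  have h : (T.map tripleCoeff).prod = partProd (inPart T) * (T.map transNumber).prod := by
    induction T using Multiset.induction with
    | empty => simp [inPart]
    | cons t T ih =>
      have : inPart (t ::ₘ T) = t.1 + inPart T := by simp [inPart]
      rw [Multiset.map_cons, Multiset.prod_cons, ih, this, partProd_add, tripleCoeff_eq,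
        Multiset.map_cons, Multiset.prod_cons]
      push_cast
      ring
  rw [collCoeff, h, collNumber]
  ring

theorem transNumber_ne_zero_of_mem {T : Multiset Triple} (h : collCoeff T ≠ 0) {t : Triple}
    (ht : t ∈ T) : transNumber t ≠ 0 := by
  rw [collCoeff_eq] at h
  intro h0
  refine h ?_
  rw [collNumber, Multiset.prod_eq_zero (Multiset.mem_map.mpr ⟨t, ht, h0⟩)]
  simp

theorem isGood_of_mem {D : Ptn} {T : Multiset Triple} (hD : IsProper D T) (h : collCoeff T ≠ 0) :
    ∀ t ∈ T, IsGood t := fun t ht =>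
  ⟨hD.2 t ht, size_pos_of_transNumber_ne_zero (transNumber_ne_zero_of_mem h ht),
    size_eq_of_transNumber_ne_zero (transNumber_ne_zero_of_mem h ht)⟩

theorem size_outPart_eq {T : Multiset Triple} (h : ∀ t ∈ T, IsGood t) :
    size (outPart T) = size (inPart T) := by
  have h1 : size (outPart T) = (T.map fun t => size t.2.2).sum :=
    (map_multiset_sum sizeHom _).trans (by rw [Multiset.map_map]; rfl)
  rw [h1, inPart_eq, size_sum_fst]
  congr 1
  exact Multiset.map_congr rfl fun t ht => (h t ht).2.2

/-! ### The action of a single class sum -/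

/-- Conjugating `s` and `r` together changes neither type. -/
theorem sum_shiftCount_eq_of_isConj {n : ℕ} {s s' : Equiv.Perm (Fin n)} (h : ptype s = ptype s')
    (D : Ptn) (f : Ptn → ℂ) :
    ∑ r : Equiv.Perm (Fin n), (shiftCount (ptype r) D : ℂ) * f (ptype (s * r)) =
      ∑ r : Equiv.Perm (Fin n), (shiftCount (ptype r) D : ℂ) * f (ptype (s' * r)) := by
  obtain ⟨g, rfl⟩ := isConj_iff.mp (ptype_eq_iff_isConj.mp h)
  refine Fintype.sum_equiv (MulAut.conj g).toEquiv _ _ fun r => ?_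
  have : g * s * g⁻¹ * (g * r * g⁻¹) = g * (s * r) * g⁻¹ := by group
  simp only [MulEquiv.toEquiv_eq_coe, EquivLike.coe_coe, MulAut.conj_apply, this, ptype_conj]

theorem pairNumber_zero_middle (Q : Ptn) : pairNumber (Q, 0, Q) = (zNumber Q)⁻¹ := by
  rw [pairNumber_eq_decompSum, decompSum]
  have h : decomp (Q, 0, Q) = {(0, Q)} := by
    ext ⟨T, P⟩
    rw [mem_decomp, Finset.mem_singleton]
    constructor
    · rintro ⟨hT, hs⟩
      have h1 : T.sum.2.1 + 0 = 0 := congrArg (fun x : Triple => x.2.1) hs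
      have h2 := card_le_size_middle fun t ht => (hT t ht).1
      rw [add_zero] at h1
      rw [h1, size_zero, Nat.le_zero, Multiset.card_eq_zero] at h2
      subst h2
      rw [Multiset.sum_zero, zero_add] at hs
      exact Prod.ext rfl (congrArg Prod.fst hs)
    · rintro ⟨⟩
      simp [diag]
  rw [h, Finset.sum_singleton]
  simp [decompWeight, collNumber, autCard]

/-- The classical class size n! / z_Q, read off from the exponential formula for pairs whose second
permutation is the identity. -/
theorem card_ptype_eq {n : ℕ} {Q : Ptn} (hQ : size Q = n) :
    ((Finset.univ.filter fun s : Equiv.Perm (Fin n) => ptype s = Q).card : ℂ) * zNumber Q =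
      (n ! : ℂ) := by
  subst hQ
  have h1 := pairNumber_zero_middle Q
  have h2 : pairNumber (Q, 0, Q) =
      ((Finset.univ.filter fun s : Equiv.Perm (Fin (size Q)) => ptype s = Q).card : ℂ) /
        ((size Q)! : ℂ) := by
    rw [pairNumber, Finset.card_eq_sum_ones, Finset.sum_filter, Fintype.sum_prod_type,
      Nat.cast_sum]
    congr 1
    refine Finset.sum_congr rfl fun s _ => ?_
    rw [Finset.sum_eq_single 1]
    · simp [pairCount, shiftCount_zero_right]
    · intro t _ ht
      simp [pairCount, shiftCount_zero_right, ht]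
    · simp
  rw [h2] at h1
  have hz := zNumber_ne_zero Q
  have hf : ((size Q)! : ℂ) ≠ 0 := by exact_mod_cast (Nat.factorial_pos _).ne'
  field_simp at h1
  exact h1

/-- The ratio of centralizer orders consists of the factor ‖Γ'‖ in W and the factor produced by the
derivative in p_{Γ'}. -/
theorem zNumber_add (Q Γ : Ptn) :
    zNumber (Q + Γ) = partProd Γ * descProd (Q + Γ) Γ * zNumber Q := by
  rw [zNumber, zNumber, partProd_add, autPtn_add]
  push_cast
  ring

/-- The collections of triples that contribute to the action of `W(D, z)` on a monomial of
exponent `Q`. -/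
def contribSet (Q D : Ptn) : Set (Multiset Triple) :=
  {T | (∀ t ∈ T, IsGood t) ∧ T.sum.2.1 = D ∧ inPart T ≤ Q}

theorem finite_contribSet (Q D : Ptn) : (contribSet Q D).Finite := by
  have hS : {t : Triple | t.1 ≤ Q ∧ t.2.1 ≤ D ∧ size t.2.2 ≤ size Q}.Finite :=
    (((Finset.Iic Q).finite_toSet.prod ((Finset.Iic D).finite_toSet.prod
      (finite_size_le (size Q))))).subset fun t ht => by simpa using ht
  refine (finite_multiset_card_le hS (size D)).subset fun T hT => ⟨fun t ht => ?_, ?_⟩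
  · have h1 : t ≤ T.sum := Multiset.single_le_sum (fun _ _ => bot_le) t ht
    have h2 : t.1 ≤ Q := h1.1.trans (by rw [← inPart_eq]; exact hT.2.2)
    refine ⟨h2, hT.2.1 ▸ h1.2.1, ?_⟩
    rw [(hT.1 t ht).2.2]
    exact size_mono h2
  · rw [← hT.2.1]
    exact card_le_size_middle fun t ht => (hT.1 t ht).1

theorem factorial_mul_pairNumber {n : ℕ} {τ : Triple} (h : size τ.1 = n) :
    (n ! : ℂ) * pairNumber τ =
      ∑ q : Equiv.Perm (Fin n) × Equiv.Perm (Fin n), (pairCount τ q : ℂ) := by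
  subst h
  rw [pairNumber, mul_div_cancel₀ _ (by exact_mod_cast (Nat.factorial_pos _).ne')]

/-- Multiplication by a class sum equals the action of W on a monomial, for each single `s`. Only
the class of `s` matters, so `s` may be averaged over it; this produces numbers of pairs, to which
the exponential formula applies. -/
theorem sum_shiftCount_mul_eq {n : ℕ} (s : Equiv.Perm (Fin n)) (D : Ptn) (f : Ptn → ℂ) :
    ∑ r : Equiv.Perm (Fin n), (shiftCount (ptype r) D : ℂ) * f (ptype (s * r)) =
      ∑ T ∈ (finite_contribSet (ptype s) D).toFinset,
        collCoeff T * descProd (ptype s) (inPart T) *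
          f (ptype s - inPart T + outPart T) := by
  classical
  set Q := ptype s with hQdef
  have hQ : size Q = n := by rw [hQdef, size_ptype, Fintype.card_fin]
  have hzQ := zNumber_ne_zero Q
  have hnf : (n ! : ℂ) ≠ 0 := by exact_mod_cast (Nat.factorial_pos _).ne'
  set A := (finite_size_le n).toFinset with hA
  have hmemA : ∀ P, P ∈ A ↔ size P ≤ n := fun P => by simp [hA]
  -- the left-hand side, averaged over the conjugacy class
  have hL : (n ! : ℂ) * ∑ r : Equiv.Perm (Fin n), (shiftCount (ptype r) D : ℂ) * f (ptype (s * r)) =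
      zNumber Q * ((n ! : ℂ) * ∑ P ∈ A, pairNumber (Q, D, P) * f P) := by
    suffices h : ((Finset.univ.filter fun s' : Equiv.Perm (Fin n) => ptype s' = Q).card : ℂ) *
        ∑ r : Equiv.Perm (Fin n), (shiftCount (ptype r) D : ℂ) * f (ptype (s * r)) =
          (n ! : ℂ) * ∑ P ∈ A, pairNumber (Q, D, P) * f P by
      rw [← h, ← card_ptype_eq hQ]
      ring
    rw [← nsmul_eq_mul, ← Finset.sum_const, Finset.sum_filter]
    have h1 : ∀ P, (n ! : ℂ) * pairNumber (Q, D, P) =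
        ∑ q : Equiv.Perm (Fin n) × Equiv.Perm (Fin n), (pairCount (Q, D, P) q : ℂ) :=
      fun P => factorial_mul_pairNumber hQ
    rw [Finset.mul_sum]
    simp only [← mul_assoc, h1, Finset.sum_mul]
    rw [Finset.sum_comm, Fintype.sum_prod_type]
    refine Finset.sum_congr rfl fun s' _ => ?_
    split_ifs with h2
    · rw [sum_shiftCount_eq_of_isConj (h2.symm : ptype s = ptype s')]
      refine Finset.sum_congr rfl fun r _ => ?_
      rw [Finset.sum_eq_single (ptype (s' * r))]
      · simp [pairCount, h2]
      · intro P _ hP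
        simp [pairCount, Ne.symm hP]
      · intro h3
        exact absurd ((hmemA _).mpr (by rw [size_ptype, Fintype.card_fin])) h3
    · symm
      refine Finset.sum_eq_zero fun r _ => Finset.sum_eq_zero fun P _ => ?_
      simp [pairCount, h2]
  apply mul_left_cancel₀ hnf
  rw [hL, mul_left_comm]
  congr 1
  simp only [pairNumber_eq_decompSum, decompSum, Finset.sum_mul, Finset.mul_sum]
  rw [Finset.sum_sigma']
  -- The collection T determines the rest: the untouched type is R = Q - Γ', and the resulting type
  -- is R + Γ.
  refine Finset.sum_bij (fun y _ => y.2.1) ?_ ?_ ?_ ?_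
  · rintro ⟨P, T, R⟩ hy
    simp only [Finset.mem_sigma, mem_decomp] at hy
    obtain ⟨_, hT, hs⟩ := hy
    have h1 : T.sum.1 + R = Q := congrArg Prod.fst hs
    have h2 : T.sum.2.1 + 0 = D := congrArg (fun x : Triple => x.2.1) hs
    rw [Set.Finite.mem_toFinset]
    exact ⟨hT, by simpa using h2, by rw [inPart_eq, ← h1]; exact le_self_add⟩
  · rintro ⟨P, T, R⟩ hy ⟨P', T', R'⟩ hy' h
    simp only [Finset.mem_sigma, mem_decomp] at hy hy'
    obtain rfl : T = T' := h
    have h1 : T.sum.1 + R = T.sum.1 + R' :=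
      (congrArg Prod.fst hy.2.2).trans (congrArg Prod.fst hy'.2.2).symm
    obtain rfl := add_left_cancel h1
    have h2 := congrArg (fun x : Triple => x.2.2) (hy.2.2.symm)
    have h3 := congrArg (fun x : Triple => x.2.2) (hy'.2.2.symm)
    obtain rfl : P = P' := h2.trans h3.symm
    rfl
  · intro T hT
    rw [Set.Finite.mem_toFinset] at hT
    obtain ⟨hg, hD, hle⟩ := hT
    obtain ⟨R, hR⟩ := exists_add_of_le hle
    refine ⟨⟨outPart T + R, (T, R)⟩, ?_, rfl⟩
    simp only [Finset.mem_sigma, mem_decomp, hmemA]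
    refine ⟨?_, hg, ?_⟩
    · rw [size_add, size_outPart_eq hg, ← size_add, ← hR, hQ]
    · rw [hR, inPart_eq, outPart_eq, ← hD]
      simp [diag, Prod.ext_iff]
  · rintro ⟨P, T, R⟩ hy
    simp only [Finset.mem_sigma, mem_decomp] at hy
    obtain ⟨_, hT, hs⟩ := hy
    have h1 : R + inPart T = Q := by rw [inPart_eq, add_comm]; exact congrArg Prod.fst hs
    have h2 : R + outPart T = P := by
      rw [outPart_eq, add_comm]; exact congrArg (fun x : Triple => x.2.2) hs
    have hz := zNumber_ne_zero R
    rw [decompWeight, ← h1, zNumber_add, add_tsub_cancel_right, h2, collCoeff_eq]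
    field_simp

/-! ### Local finiteness of the cut-and-join operators -/

theorem ptype_apply_one {α : Type*} [Fintype α] [DecidableEq α] (s : Equiv.Perm α) :
    ptype s 1 = Fintype.card α - s.support.card := by
  rw [ptype, ofParts_apply, Equiv.Perm.parts_partition, Multiset.count_add, PNat.one_coe,
    Multiset.count_replicate_self, Multiset.count_eq_zero_of_notMem, zero_add]
  exact fun h => absurd (Equiv.Perm.two_le_of_mem_cycleType h) (by norm_num)

/-- A fixed point of `s * r` not moved by `r` is fixed by both, hence is the whole orbit, and the
degree is 1. Otherwise all fixed points of `s * r` are moved by `r`, which moves at most |Δ^i|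
points. This is needed in the shifted variables: p_1 + 1 has a constant term, so the output exponent
does not bound m_1(Γ). -/
theorem apply_one_le_of_transNumber_ne_zero {t : Triple} (h : transNumber t ≠ 0)
    (h1 : 1 ≤ size t.2.1) : t.2.2 1 ≤ size t.2.1 := by
  obtain ⟨⟨s, r⟩, hq, _, h2, h3⟩ := exists_of_transNumber_ne_zero h
  by_cases hx : ∃ x, (s * r) x = x ∧ r x = x
  · obtain ⟨x, hx1, hx2⟩ := hx
    have hs : s x = x := by
      rw [Equiv.Perm.mul_apply, hx2] at hx1
      exact hx1
    have hfix : ∀ w ∈ Subgroup.closure {s, r}, w x = x := by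
      intro w hw
      have : Subgroup.closure {s, r} ≤ MulAction.stabilizer (Equiv.Perm (Fin (size t.1))) x := by
        rw [Subgroup.closure_le]
        rintro _ (rfl | rfl)
        · exact hs
        · exact hx2
      exact this hw
    have hsub : Subsingleton (Fin (size t.1)) := by
      have : ∀ y, y = x := fun y => by
        obtain ⟨w, hw, hwy⟩ := hq.2 x y
        rw [← hwy, hfix w hw]
      exact ⟨fun a b => (this a).trans (this b).symm⟩
    have hn : size t.1 ≤ 1 := by
      rw [← Fintype.card_fin (size t.1)]
      exact Fintype.card_le_one_iff_subsingleton.mpr hsub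
    have := apply_le_size t.2.2 1
    rw [size_eq_of_transNumber_ne_zero h] at this
    omega
  · push Not at hx
    have hsub : (s * r).supportᶜ ⊆ r.support := fun x hx' => by
      rw [Finset.mem_compl, Equiv.Perm.mem_support, not_not] at hx'
      exact Equiv.Perm.mem_support.mpr (hx x hx')
    have hc := Finset.card_le_card hsub
    rw [Finset.card_compl, ← ptype_apply_one] at hc
    obtain ⟨h4, h5⟩ := shiftCount_ne_zero h3
    have h6 := ptype_apply_one r
    have h7 := r.support.card_le_univ
    rw [h4] at h6
    simp only [size_ptype, Fintype.card_fin, Finsupp.add_apply, Finsupp.single_eq_same] at h5 h6 h7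
    rw [← h2]
    simp only at h2 hc ⊢
    omega

/-- The collections of triples that contribute to the coefficient of exponent `P`. -/
def activeSet (D P : Ptn) : Set (Multiset Triple) :=
  {T | IsProper D T ∧ collCoeff T ≠ 0 ∧ ∀ a, a ≠ 1 → outPart T a ≤ P a}

/-- The exponent `P` bounds the multiplicities in Γ of parts larger than 1, and |D| bounds that of
1; then |Γ'_i| = |Γ_i| bounds the rest. No series enters, so one finite set serves all of them. -/
theorem finite_activeSet (D P : Ptn) : (activeSet D P).Finite := by
  set P' := P + Finsupp.single 1 (size D)
  have hS : {t : Triple | size t.1 ≤ size P' ∧ t.2.1 ≤ D ∧ t.2.2 ≤ P'}.Finite :=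
    ((finite_size_le (size P')).prod ((Finset.Iic D).finite_toSet.prod
      (Finset.Iic P').finite_toSet)).subset fun t ht =>
        ⟨ht.1, by simpa using ht.2.1, by simpa using ht.2.2⟩
  refine (finite_multiset_card_le hS (size D)).subset fun T hT => ?_
  obtain ⟨hD, hc, hP⟩ := hT
  have hD' : T.sum.2.1 = D := by rw [← sum_middle_eq]; exact hD.1
  have hout : outPart T ≤ P' := by
    intro a
    by_cases ha : a = 1
    · subst ha
      have h1 : outPart T 1 ≤ size D := by
        have h2 : outPart T 1 = (T.map fun t => t.2.2 1).sum :=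
          (map_multiset_sum (Finsupp.applyAddHom (M := ℕ) (1 : ℕ+)) _).trans (by rw [Multiset.map_map]; rfl)
        rw [h2, ← hD', size_sum_middle]
        exact Multiset.sum_map_le_sum_map _ _ fun t ht =>
          apply_one_le_of_transNumber_ne_zero (transNumber_ne_zero_of_mem hc ht) (hD.2 t ht)
      simp only [P', Finsupp.add_apply, Finsupp.single_eq_same]
      omega
    · exact (hP a ha).trans (by simp [P'])
  refine ⟨fun t ht => ?_, hD' ▸ card_le_size_middle hD.2⟩
  have h1 : t ≤ T.sum := Multiset.single_le_sum (fun _ _ => bot_le) t ht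
  have h2 : t.2.2 ≤ P' := h1.2.2.trans (by rw [← outPart_eq]; exact hout)
  exact ⟨by rw [← (isGood_of_mem hD hc t ht).2.2]; exact size_mono h2, hD' ▸ h1.2.1, h2⟩

theorem coeff_partialP (Γ P : Ptn) (f : MvPowerSeries ℕ+ ℂ) :
    MvPowerSeries.coeff P (partialP Γ f) =
      ((Γ.prod fun a k => (P a + k).descFactorial k : ℕ) : ℂ) * MvPowerSeries.coeff (P + Γ) f :=
  rfl

theorem coeff_cutJoinTerm (x : ℕ+ → MvPowerSeries ℕ+ ℂ) {m k : ℕ} (D : Ptn) (T : Multiset Triple)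
    (F : Series m k) (e : ℤ) (l : Fin m → ℕ) (G : Fin k → Ptn) (P : Ptn) :
    MvPowerSeries.coeff P (cutJoinTerm x D T F e l G) =
      ∑ p ∈ Finset.HasAntidiagonal.antidiagonal P, collCoeff T * (MvPowerSeries.coeff p.1 (mon x (outPart T)) *
        (((inPart T).prod fun a k => (p.2 a + k).descFactorial k : ℕ) : ℂ)) *
          MvPowerSeries.coeff (p.2 + inPart T) (F (e - zExp D T) l G) := by
  classical
  rw [cutJoinTerm, MvPowerSeries.coeff_smul, MvPowerSeries.coeff_mul, Finset.mul_sum]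
  refine Finset.sum_congr rfl fun p _ => ?_
  rw [monom_eq_mon, coeff_partialP]
  ring

theorem mem_activeSet_of_coeff_ne_zero (c : ℂ) {m k : ℕ} {D : Ptn} {T : Multiset Triple}
    (hT : IsProper D T) {F : Series m k} {e : ℤ} {l : Fin m → ℕ} {G : Fin k → Ptn} {P : Ptn}
    (h : MvPowerSeries.coeff P (cutJoinTerm (timeShift c) D T F e l G) ≠ 0) :
    T ∈ activeSet D P := by
  rw [coeff_cutJoinTerm] at h
  obtain ⟨p, hp, hne⟩ := Finset.exists_ne_zero_of_sum_ne_zero h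
  have h1 := left_ne_zero_of_mul hne
  have h2 := left_ne_zero_of_mul (right_ne_zero_of_mul h1)
  refine ⟨hT, left_ne_zero_of_mul h1, fun a ha => ?_⟩
  rw [coeff_mon_timeShift] at h2
  have h3 : shiftCount (outPart T) p.1 ≠ 0 := by exact_mod_cast left_ne_zero_of_mul h2
  have h4 : (outPart T).erase 1 = p.1.erase 1 := by
    by_contra h5
    exact h3 (if_neg h5)
  have h6 := DFunLike.congr_fun h4 a
  rw [Finsupp.erase_ne ha, Finsupp.erase_ne ha] at h6
  rw [h6, ← Finset.HasAntidiagonal.mem_antidiagonal.mp hp]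
  simp

theorem isLocallyFinite_timeShift (c : ℂ) (m k : ℕ) (D : Ptn) :
    IsLocallyFinite (timeShift c) m k D := fun _ _ _ _ P =>
  (finite_activeSet D P).subset fun _ hT => mem_activeSet_of_coeff_ne_zero c hT.1 hT.2

theorem W_eq_sum (x : ℕ+ → MvPowerSeries ℕ+ ℂ) {m k : ℕ} {D : Ptn} (F : Series m k) (e : ℤ)
    (l : Fin m → ℕ) (G : Fin k → Ptn) (P : Ptn) (S : Finset (Multiset Triple))
    (h1 : ∀ T ∈ S, IsProper D T)
    (h2 : ∀ T, IsProper D T → MvPowerSeries.coeff P (cutJoinTerm x D T F e l G) ≠ 0 → T ∈ S) :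
    W x D F e l G P = ∑ T ∈ S, MvPowerSeries.coeff P (cutJoinTerm x D T F e l G) := by
  refine finsum_mem_eq_sum_of_inter_support_eq (s := {T | IsProper D T}) _ ?_
  ext T
  simp only [Set.mem_inter_iff, Set.mem_ofPred_eq, Function.mem_support, Finset.mem_coe]
  exact ⟨fun h => ⟨h2 T h.1 h.2, h.2⟩, fun h => ⟨h1 T h.1, h.2⟩⟩

/-- The sum of a family of series, coefficient by coefficient. -/
def coeffSum {m k : ℕ} (F : ℕ → Series m k) : Series m k :=
  fun e l G P => ∑ᶠ n, MvPowerSeries.coeff P (F n e l G)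

/-- The finite set of contributing collections is common to all n, so the two sums can be exchanged.
-/
theorem W_coeffSum (c : ℂ) {m k : ℕ} (D : Ptn) (F : ℕ → Series m k)
    (hF : ∀ e l G P, {n | MvPowerSeries.coeff P (F n e l G) ≠ 0}.Finite) :
    W (timeShift c) D (coeffSum F) = coeffSum fun n => W (timeShift c) D (F n) := by
  funext e l G P
  have hS : ∀ T ∈ (finite_activeSet D P).toFinset, IsProper D T := fun T hT => by
    rw [Set.Finite.mem_toFinset] at hT
    exact hT.1
  have hS' : ∀ F' : Series m k, ∀ T, IsProper D T →
      MvPowerSeries.coeff P (cutJoinTerm (timeShift c) D T F' e l G) ≠ 0 →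
        T ∈ (finite_activeSet D P).toFinset := fun F' T hT h => by
    rw [Set.Finite.mem_toFinset]
    exact mem_activeSet_of_coeff_ne_zero c hT h
  rw [W_eq_sum _ _ e l G P _ hS (hS' _), coeffSum]
  have h1 : ∀ n, MvPowerSeries.coeff P (W (timeShift c) D (F n) e l G) = _ := fun n =>
    W_eq_sum _ _ e l G P _ hS (hS' (F n))
  simp only [h1, coeff_cutJoinTerm]
  have hfin : ∀ (a : ℂ) (e l G P),
      (Function.support fun n => a * MvPowerSeries.coeff P (F n e l G)).Finite := fun a e l G P =>
    (hF e l G P).subset fun n hn => right_ne_zero_of_mul hn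
  rw [finsum_sum_comm]
  · refine Finset.sum_congr rfl fun T _ => ?_
    rw [finsum_sum_comm _ _ fun p _ => hfin _ _ _ _ _]
    refine Finset.sum_congr rfl fun p _ => ?_
    rw [← mul_finsum]
    rfl
  · intro T _
    refine (Set.Finite.biUnion (Finset.finite_toSet (Finset.HasAntidiagonal.antidiagonal P)) fun p _ =>
      hF (e - zExp D T) l G (p.2 + inPart T)).subset fun n hn => ?_
    obtain ⟨p, hp, hne⟩ := Finset.exists_ne_zero_of_sum_ne_zero hn
    exact Set.mem_biUnion hp (right_ne_zero_of_mul hne)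

/-! ### The action of the cut-and-join operators on class functions -/

/-- The generating series of the cycle types of permutations of `n` points with weights `B`, where
`z` records the number of cycles. -/
def permSeries {m k : ℕ} (c : ℂ) (n : ℕ) (E : (Fin m → ℕ) → (Fin k → Ptn) → ℤ)
    (B : (Fin m → ℕ) → (Fin k → Ptn) → Equiv.Perm (Fin n) → ℂ) : Series m k :=
  fun e l G => ∑ s : Equiv.Perm (Fin n),
    (B l G s * if e = E l G - len (ptype s) then 1 else 0) • mon (timeShift c) (ptype s)

theorem partialP_smul (Γ : Ptn) (a : ℂ) (f : MvPowerSeries ℕ+ ℂ) :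
    partialP Γ (a • f) = a • partialP Γ f := by
  ext P
  simp only [MvPowerSeries.coeff_smul, coeff_partialP]
  ring

theorem partialP_sum {ι : Type*} (Γ : Ptn) (s : Finset ι) (f : ι → MvPowerSeries ℕ+ ℂ) :
    partialP Γ (∑ i ∈ s, f i) = ∑ i ∈ s, partialP Γ (f i) := by
  ext P
  simp only [map_sum, coeff_partialP, Finset.mul_sum]

/-- The part l(Γ') - l(Γ) of the exponent of z is compensated by the change in the number of cycles,
so the form E - l(type) persists, with E raised by |Δ| - l(Δ). -/
theorem coeff_cutJoinTerm_permSeries {m k : ℕ} (c : ℂ) (n : ℕ)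
    (E : (Fin m → ℕ) → (Fin k → Ptn) → ℤ)
    (B : (Fin m → ℕ) → (Fin k → Ptn) → Equiv.Perm (Fin n) → ℂ) (D : Ptn) (T : Multiset Triple)
    (e : ℤ) (l : Fin m → ℕ) (G : Fin k → Ptn) (P : Ptn) :
    MvPowerSeries.coeff P (cutJoinTerm (timeShift c) D T (permSeries c n E B) e l G) =
      ∑ s : Equiv.Perm (Fin n), B l G s * (collCoeff T * descProd (ptype s) (inPart T) *
        ((if e = E l G + (size D - len D) - len (ptype s - inPart T + outPart T) then 1 else 0) *
          MvPowerSeries.coeff P (mon (timeShift c) (ptype s - inPart T + outPart T)))) := by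
  rw [cutJoinTerm, permSeries, partialP_sum, Finset.mul_sum, Finset.smul_sum, map_sum]
  refine Finset.sum_congr rfl fun s _ => ?_
  rw [partialP_smul, partialP_mon_timeShift, monom_eq_mon, mul_smul_comm, mul_smul_comm,
    mul_comm (mon _ _), ← mon_add, MvPowerSeries.coeff_smul, MvPowerSeries.coeff_smul,
    MvPowerSeries.coeff_smul]
  by_cases h : inPart T ≤ ptype s
  · obtain ⟨R, hR⟩ := exists_add_of_le h
    have hlen : (e - zExp D T = E l G - len (ptype s)) ↔
        e = E l G + (size D - len D) - len (ptype s - inPart T + outPart T) := by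
      rw [hR, add_tsub_cancel_left, len_add, len_add, zExp]
      push_cast
      constructor <;> intro h <;> linarith
    simp only [hlen]
    ring
  -- Here `ptype s - inPart T` is truncated, but the derivative kills the monomial.
  · rw [descProd_eq_zero h]
    simp

/-- Since the action on a monomial is known for each `s` separately, `B` need not be a class
function; reindexing s * r moves the action from monomials to weights. -/
theorem W_permSeries {m k : ℕ} (c : ℂ) (n : ℕ) (E : (Fin m → ℕ) → (Fin k → Ptn) → ℤ)
    (B : (Fin m → ℕ) → (Fin k → Ptn) → Equiv.Perm (Fin n) → ℂ) (D : Ptn) :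
    W (timeShift c) D (permSeries c n E B) =
      permSeries c n (fun l G => E l G + (size D - len D)) fun l G s =>
        ∑ r : Equiv.Perm (Fin n), shiftCount (ptype r) D * B l G (s * r⁻¹) := by
  funext e l G
  ext P
  have hmemS : ∀ Q T, T ∈ (finite_contribSet Q D).toFinset ↔ T ∈ contribSet Q D :=
    fun Q T => Set.Finite.mem_toFinset _
  have hW : MvPowerSeries.coeff P (W (timeShift c) D (permSeries c n E B) e l G) = _ :=
    W_eq_sum (timeShift c) (permSeries c n E B) e l G P
      -- The collections that can act on the type of some `s`; for a given `s` the superfluous ones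
      -- contribute 0.
      (Finset.univ.biUnion fun s : Equiv.Perm (Fin n) => (finite_contribSet (ptype s) D).toFinset)
      (fun T hT => by
        obtain ⟨s, _, hs⟩ := Finset.mem_biUnion.mp hT
        rw [hmemS] at hs
        exact ⟨(sum_middle_eq T).trans hs.2.1, fun t ht => (hs.1 t ht).1⟩)
      (fun T hT hne => by
        rw [coeff_cutJoinTerm_permSeries] at hne
        obtain ⟨s, _, hs⟩ := Finset.exists_ne_zero_of_sum_ne_zero hne
        have h1 := left_ne_zero_of_mul (right_ne_zero_of_mul hs)
        refine Finset.mem_biUnion.mpr ⟨s, Finset.mem_univ s, (hmemS _ _).mpr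
          ⟨isGood_of_mem hT (left_ne_zero_of_mul h1), (sum_middle_eq T).symm.trans hT.1, ?_⟩⟩
        by_contra h2
        exact right_ne_zero_of_mul h1 (by rw [descProd_eq_zero h2, Nat.cast_zero]))
  rw [hW]
  simp only [coeff_cutJoinTerm_permSeries]
  rw [Finset.sum_comm]
  set f : Ptn → ℂ := fun R => (if e = E l G + (size D - len D) - len R then 1 else 0) *
    MvPowerSeries.coeff P (mon (timeShift c) R) with hf
  have h1 : ∀ s : Equiv.Perm (Fin n), ∑ T ∈ Finset.univ.biUnion
      (fun s : Equiv.Perm (Fin n) => (finite_contribSet (ptype s) D).toFinset),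
        B l G s * (collCoeff T * descProd (ptype s) (inPart T) *
          f (ptype s - inPart T + outPart T)) =
      B l G s * ∑ r : Equiv.Perm (Fin n), (shiftCount (ptype r) D : ℂ) * f (ptype (s * r)) := by
    intro s
    rw [sum_shiftCount_mul_eq, Finset.mul_sum]
    symm
    refine Finset.sum_subset (Finset.subset_biUnion_of_mem
      (fun s : Equiv.Perm (Fin n) => (finite_contribSet (ptype s) D).toFinset)
      (Finset.mem_univ s)) fun T hT hT' => ?_
    obtain ⟨s', _, hs'⟩ := Finset.mem_biUnion.mp hT
    rw [hmemS] at hs' hT'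
    rw [descProd_eq_zero fun h => hT' ⟨hs'.1, hs'.2.1, h⟩]
    simp
  rw [Finset.sum_congr rfl fun s _ => h1 s, permSeries, map_sum]
  simp only [MvPowerSeries.coeff_smul, Finset.mul_sum, Finset.sum_mul]
  rw [Finset.sum_comm]
  conv_rhs => rw [Finset.sum_comm]
  refine Finset.sum_congr rfl fun r _ => ?_
  refine Fintype.sum_equiv (Equiv.mulRight r) _ _ fun s => ?_
  rw [show Equiv.mulRight r s = s * r from rfl, mul_inv_cancel_right]
  simp only [hf]
  ring

/-! ### Hurwitz numbers in the group algebra -/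

/-- The sum of all permutations, weighted by the number of ways to see them as having shifted cycle
type `D`. -/
def classSum (n : ℕ) (D : Ptn) : MonoidAlgebra ℂ (Equiv.Perm (Fin n)) :=
  ∑ s, MonoidAlgebra.single s (shiftCount (ptype s) D : ℂ)

/-- The product of commutators in the relation between the monodromies. -/
def commProd {g n : ℕ} (x : (Fin g → Equiv.Perm (Fin n)) × (Fin g → Equiv.Perm (Fin n))) :
    Equiv.Perm (Fin n) :=
  (List.ofFn fun j => x.1 j * x.2 j * (x.1 j)⁻¹ * (x.2 j)⁻¹).prod

/-- The sum of all products of `g` commutators. -/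
def commSum (g n : ℕ) : MonoidAlgebra ℂ (Equiv.Perm (Fin n)) :=
  ∑ x : (Fin g → Equiv.Perm (Fin n)) × (Fin g → Equiv.Perm (Fin n)),
    MonoidAlgebra.single (commProd x) 1

theorem classSum_commute (n : ℕ) (D : Ptn) (x : MonoidAlgebra ℂ (Equiv.Perm (Fin n))) :
    Commute (classSum n D) x := by
  induction x using MonoidAlgebra.induction_linear with
  | zero => exact Commute.zero_right _
  | add f g hf hg => exact hf.add_right hg
  | single t c =>
    rw [Commute, SemiconjBy, classSum, Finset.sum_mul, Finset.mul_sum]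
    symm
    refine Fintype.sum_equiv (MulAut.conj t).toEquiv _ _ fun s => ?_
    rw [MonoidAlgebra.single_mul_single, MonoidAlgebra.single_mul_single]
    simp only [MulEquiv.toEquiv_eq_coe, EquivLike.coe_coe, MulAut.conj_apply, ptype_conj]
    rw [mul_comm c, inv_mul_cancel_right]

theorem prod_classSum (n : ℕ) (L : List Ptn) :
    (L.map (classSum n)).prod = ∑ s : Fin L.length → Equiv.Perm (Fin n),
      MonoidAlgebra.single (List.ofFn s).prod
        (∏ i, (shiftCount (ptype (s i)) (L.get i) : ℂ)) := by
  induction L with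
  | nil => simp [MonoidAlgebra.one_def]
  | cons D L ih =>
    rw [List.map_cons, List.prod_cons, ih, classSum, Finset.sum_mul_sum, ← Fintype.sum_prod_type']
    refine Fintype.sum_equiv (Fin.consEquiv fun _ => Equiv.Perm (Fin n)) _ _ fun x => ?_
    rw [MonoidAlgebra.single_mul_single]
    simp only [List.length_cons, Fin.consEquiv_apply]
    rw [List.ofFn_succ, List.prod_cons, Fin.prod_univ_succ]
    simp

/-- The number of monodromy data, weighted by the shift factors, with ramification types `L`. -/
def rawNumber (g n : ℕ) (L : List Ptn) : ℂ :=
  (commSum g n * (L.map (classSum n)).prod).coeff 1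

theorem rawNumber_eq_sum (g n : ℕ) (L : List Ptn) :
    rawNumber g n L = ∑ x : (Fin g → Equiv.Perm (Fin n)) × (Fin g → Equiv.Perm (Fin n)),
      ∑ s : Fin L.length → Equiv.Perm (Fin n), if commProd x * (List.ofFn s).prod = 1 then
        ∏ i, (shiftCount (ptype (s i)) (L.get i) : ℂ) else 0 := by
  rw [rawNumber, prod_classSum, commSum, Finset.sum_mul_sum, MonoidAlgebra.coeff_sum,
    Finsupp.finsetSum_apply]
  refine Finset.sum_congr rfl fun x _ => ?_
  rw [MonoidAlgebra.coeff_sum, Finsupp.finsetSum_apply]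
  refine Finset.sum_congr rfl fun s _ => ?_
  rw [MonoidAlgebra.single_mul_single, MonoidAlgebra.coeff_single, Finsupp.single_apply, one_mul]

theorem prod_shiftCount (n : ℕ) (L : List Ptn) (s : Fin L.length → Equiv.Perm (Fin n)) :
    ∏ i, (shiftCount (ptype (s i)) (L.get i) : ℂ) =
      if ∀ i, (s i).partition.parts = shiftParts n (L.get i) then (shiftFactor n L : ℂ) else 0 := by
  have h : ∀ i, shiftCount (ptype (s i)) (L.get i) =
      if (s i).partition.parts = shiftParts n (L.get i) then
        (n - size (L.get i) + (L.get i) 1).choose ((L.get i) 1) else 0 := fun i => by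
    rw [shiftCount_eq n _ _ (by rw [size_ptype, Fintype.card_fin]), toParts_ptype]
  have h2 : shiftFactor n L =
      ∏ i : Fin L.length, (n - size (L.get i) + (L.get i) 1).choose ((L.get i) 1) :=
    (Fin.prod_univ_fun_getElem L fun D => (n - size D + D 1).choose (D 1)).symm
  rw [← Nat.cast_prod, Finset.prod_congr rfl fun i _ => h i, Finset.prod_ite_zero, ← h2]
  simp

/-- The contribution of the ramification types `L` to the Euler characteristic of a covering. -/
def ramChar (L : List Ptn) : ℤ := (L.map fun D => (len D : ℤ) - size D).sum

theorem eulerChar_of_types {g n : ℕ} {L : List Ptn} (M : Monodromy g n L.length)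
    (h : ∀ i, (M.s i).partition.parts = shiftParts n (L.get i)) :
    M.eulerChar = n * (2 - 2 * g) + ramChar L := by
  have h1 : ∑ i, ((M.s i).partition.parts.card : ℤ) =
      ∑ i : Fin L.length, (((len (L.get i) : ℤ) - size (L.get i)) + n) :=
    Finset.sum_congr rfl fun i _ => by rw [(parts_card_of_eq_shiftParts (h i)).2]; ring
  have h2 : ∑ i : Fin L.length, ((len (L.get i) : ℤ) - size (L.get i)) = ramChar L :=
    Fin.sum_univ_fun_getElem L fun D => (len D : ℤ) - size D
  rw [Monodromy.eulerChar, h1, Finset.sum_add_distrib, h2]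
  simp
  ring

/-- Monodromy data as tuples of permutations. -/
def monodromyEquiv (g n r : ℕ) : Monodromy g n r ≃
    {x : ((Fin g → Equiv.Perm (Fin n)) × (Fin g → Equiv.Perm (Fin n))) ×
      (Fin r → Equiv.Perm (Fin n)) // commProd x.1 * (List.ofFn x.2).prod = 1} where
  toFun M := ⟨((M.a, M.b), M.s), M.rel⟩
  invFun x := ⟨x.1.1.1, x.1.1.2, x.1.2, x.2⟩
  left_inv _ := rfl
  right_inv _ := rfl

/-- The ramification types fix the Euler characteristic, so at most one h contributes, and the marks
already account for the shift factor. -/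
theorem U_eq (g : ℕ) (h : ℤ) (n : ℕ) (L : List Ptn) :
    U g h n L = if n * (2 - 2 * g) + ramChar L = 2 - 2 * h then
      rawNumber g n L / (n ! : ℂ) else 0 := by
  classical
  rw [U, hurwitz, ← mul_div_assoc]
  split_ifs with he
  · congr 1
    have hcard : Nat.card {M : Monodromy g n L.length // M.IsCover h L} =
        (Finset.univ.filter fun x : ((Fin g → Equiv.Perm (Fin n)) × (Fin g → Equiv.Perm (Fin n))) ×
          (Fin L.length → Equiv.Perm (Fin n)) => commProd x.1 * (List.ofFn x.2).prod = 1 ∧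
            ∀ i, (x.2 i).partition.parts = shiftParts n (L.get i)).card := by
      have e1 : {M : Monodromy g n L.length // M.IsCover h L} ≃
          {x : {x : ((Fin g → Equiv.Perm (Fin n)) × (Fin g → Equiv.Perm (Fin n))) ×
            (Fin L.length → Equiv.Perm (Fin n)) // commProd x.1 * (List.ofFn x.2).prod = 1} //
              ∀ i, (x.1.2 i).partition.parts = shiftParts n (L.get i)} :=
        (monodromyEquiv g n L.length).subtypeEquiv fun M =>
          ⟨fun hM => hM.2, fun hM => ⟨(eulerChar_of_types M hM).trans he, hM⟩⟩
      rw [Nat.card_congr (e1.trans (Equiv.subtypeSubtypeEquivSubtypeInter _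
        fun x : ((Fin g → Equiv.Perm (Fin n)) × (Fin g → Equiv.Perm (Fin n))) ×
          (Fin L.length → Equiv.Perm (Fin n)) =>
            ∀ i, (x.2 i).partition.parts = shiftParts n (L.get i))),
        Nat.card_eq_fintype_card, Fintype.card_subtype]
    rw [hcard, rawNumber_eq_sum, Finset.card_eq_sum_ones, Finset.sum_filter, Nat.cast_sum,
      Finset.mul_sum, Fintype.sum_prod_type]
    refine Finset.sum_congr rfl fun x _ => Finset.sum_congr rfl fun s _ => ?_
    rw [prod_shiftCount]
    by_cases h1 : commProd x * (List.ofFn s).prod = 1 <;>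
      by_cases h2 : ∀ i, (s i).partition.parts = shiftParts n (L.get i) <;> simp [h1, h2]
  · have : IsEmpty {M : Monodromy g n L.length // M.IsCover h L} :=
      ⟨fun M => he ((eulerChar_of_types M.1 M.2.2).symm.trans M.2.1)⟩
    rw [Nat.card_of_isEmpty]
    simp

/-- Take signs in the defining relation: commutators are even. Since Φ only runs over integers h,
this is what makes the odd powers of z vanish on the permutation side as well. -/
theorem even_ramChar_of_rawNumber_ne_zero {g n : ℕ} {L : List Ptn} (h : rawNumber g n L ≠ 0) :
    Even (ramChar L) := by
  rw [rawNumber_eq_sum] at h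
  obtain ⟨x, _, hx⟩ := Finset.exists_ne_zero_of_sum_ne_zero h
  obtain ⟨s, _, hs⟩ := Finset.exists_ne_zero_of_sum_ne_zero hx
  have hrel : commProd x * (List.ofFn s).prod = 1 := by
    by_contra h'
    exact hs (if_neg h')
  rw [if_pos hrel] at hs
  have hsc : ∀ i, shiftCount (ptype (s i)) (L.get i) ≠ 0 := fun i => by
    exact_mod_cast Finset.prod_ne_zero_iff.mp hs i (Finset.mem_univ i)
  have hsign : ∀ i, Equiv.Perm.sign (s i) =
      (-1 : ℤˣ) ^ ((len (L.get i) : ℤ) - size (L.get i)) := by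
    intro i
    have h1 := (shiftCount_ne_zero (hsc i)).1
    apply Units.ext
    rw [sign_eq_neg_one_pow, h1, size_add, len_add, size_single, len_single]
    generalize size (ptype (s i)) - size (L.get i) = j
    have h2 : (size (L.get i) + ((1 : ℕ+) : ℕ) * j + (len (L.get i) + j)) =
      (size (L.get i) + len (L.get i)) + 2 * j := by simp; ring
    rw [h2, pow_add, pow_mul, neg_one_sq, one_pow, mul_one]
    have h3 : (-1 : ℤˣ) ^ ((len (L.get i) : ℤ) - size (L.get i)) =
        (-1 : ℤˣ) ^ (size (L.get i) + len (L.get i)) := by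
      rw [zpow_sub, zpow_natCast, zpow_natCast, pow_add, mul_comm, ← inv_pow, Int.units_inv_eq_self]
    rw [h3]
    push_cast
    rfl
  have hcomm : Equiv.Perm.sign (commProd x) = 1 := by
    rw [commProd, map_list_prod, List.prod_eq_one]
    intro y hy
    rw [List.mem_map] at hy
    obtain ⟨z, hz, rfl⟩ := hy
    obtain ⟨j, rfl⟩ := (List.mem_ofFn' _ _).mp hz
    simp only [map_mul, map_inv]
    rw [mul_right_comm (Equiv.Perm.sign (x.1 j))]
    simp
  have h1 := congrArg Equiv.Perm.sign hrel
  have h2 : ∑ i : Fin L.length, ((len (L.get i) : ℤ) - size (L.get i)) = ramChar L :=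
    Fin.sum_univ_fun_getElem L fun D => (len D : ℤ) - size D
  rw [map_mul, hcomm, one_mul, map_one, map_list_prod, List.map_ofFn, List.prod_ofFn] at h1
  simp only [Function.comp, hsign] at h1
  have h3 : ∏ i, (-1 : ℤˣ) ^ ((len (L.get i) : ℤ) - size (L.get i)) = (-1 : ℤˣ) ^ ramChar L := by
    rw [← h2]
    exact (map_sum (zpowersHom ℤˣ (-1)).toAdditiveRight _ _).symm
  rw [h3] at h1
  by_contra hodd
  rw [Int.not_even_iff_odd] at hodd
  obtain ⟨r, hr⟩ := hodd
  rw [hr, zpow_add, zpow_mul] at h1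
  norm_num at h1

/-- The weights of the last monodromy: the number of all other monodromy data. -/
def tailWeight (g n : ℕ) (L : List Ptn) (s : Equiv.Perm (Fin n)) : ℂ :=
  (commSum g n * (L.map (classSum n)).prod).coeff s⁻¹

theorem rawNumber_append_singleton (g n : ℕ) (L : List Ptn) (P : Ptn) :
    rawNumber g n (L ++ [P]) =
      ∑ s : Equiv.Perm (Fin n), tailWeight g n L s * (shiftCount (ptype s) P : ℂ) := by
  rw [rawNumber, List.map_append, List.prod_append, List.map_singleton, List.prod_singleton,
    ← mul_assoc, classSum, Finset.mul_sum, MonoidAlgebra.coeff_sum, Finsupp.finsetSum_apply]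
  refine Finset.sum_congr rfl fun s _ => ?_
  rw [MonoidAlgebra.coeff_mul_single_apply, one_mul]
  rfl

theorem tailWeight_perm (g n : ℕ) {L L' : List Ptn} (h : L.Perm L') :
    tailWeight g n L = tailWeight g n L' := by
  funext s
  rw [tailWeight, tailWeight, (h.map (classSum n)).prod_eq']
  exact List.pairwise_map.mpr (List.pairwise_of_forall fun D _ => classSum_commute n D _)

/-- By centrality the new class sum can be moved in front of `commSum`, where it acts by left
multiplication. -/
theorem tailWeight_cons (g n : ℕ) (D : Ptn) (L : List Ptn) (s : Equiv.Perm (Fin n)) :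
    tailWeight g n (D :: L) s =
      ∑ r : Equiv.Perm (Fin n), shiftCount (ptype r) D * tailWeight g n L (s * r⁻¹) := by
  rw [tailWeight, List.map_cons, List.prod_cons, ← mul_assoc,
    ← (classSum_commute n D (commSum g n)).eq, mul_assoc, classSum, Finset.sum_mul,
    MonoidAlgebra.coeff_sum, Finsupp.finsetSum_apply]
  -- Replacing r by its inverse keeps the cycle type and turns the argument into s * r⁻¹.
  refine Fintype.sum_equiv (Equiv.inv _) _ _ fun r => ?_
  rw [MonoidAlgebra.coeff_single_mul_apply, Equiv.inv_apply, ptype_inv, tailWeight, mul_inv_rev,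
    inv_inv]

/-! ### The generating functions -/

section Generating

variable {m k : ℕ}

/-- All ramification types but the last one. -/
def headProfile (D : Fin m → Ptn) (l : Fin m → ℕ) (G : Fin k → Ptn) : List Ptn :=
  (List.ofFn fun j => List.replicate (l j) (D j)).flatten ++ List.ofFn G

theorem profile_eq (D : Fin m → Ptn) (l : Fin m → ℕ) (G : Fin k → Ptn) (P : Ptn) :
    profile D l G P = headProfile D l G ++ [P] := rfl

/-- The new copy lands inside the i-th block of the list; commuting class sums make its position
irrelevant. -/
theorem headProfile_add_single (D : Fin m → Ptn) (l : Fin m → ℕ) (G : Fin k → Ptn) (i : Fin m) :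
    (headProfile D (l + Pi.single i 1) G).Perm (D i :: headProfile D l G) := by
  classical
  rw [List.perm_iff_count]
  intro A
  rw [headProfile, headProfile, List.count_append, List.count_cons, List.count_append,
    List.count_flatten, List.count_flatten, List.map_ofFn, List.map_ofFn, List.sum_ofFn,
    List.sum_ofFn]
  have h : ∀ j, (l + Pi.single i 1 : Fin m → ℕ) j = l j + if j = i then 1 else 0 := fun j => by
    rw [Pi.add_apply, Pi.single_apply]
  have h2 : ∑ j, (if D j = A then if j = i then 1 else 0 else 0) = if D i = A then 1 else 0 := by
    rw [Finset.sum_eq_single i]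
    · simp
    · intro j _ hj
      simp [hj]
    · simp
  have h3 : ∑ j, (List.count A ∘ fun j => List.replicate ((l + Pi.single i 1 : Fin m → ℕ) j) (D j)) j =
      ∑ j, (List.count A ∘ fun j => List.replicate (l j) (D j)) j +
        ∑ j, (if D j = A then if j = i then 1 else 0 else 0) := by
    rw [← Finset.sum_add_distrib]
    refine Finset.sum_congr rfl fun j _ => ?_
    simp only [Function.comp, List.count_replicate, h, beq_iff_eq]
    split_ifs <;> simp
  rw [h3, h2]
  simp only [beq_iff_eq]
  ring

theorem ramChar_perm {L L' : List Ptn} (h : L.Perm L') : ramChar L = ramChar L' :=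
  (h.map _).sum_eq

theorem ramChar_append_singleton (L : List Ptn) (P : Ptn) :
    ramChar (L ++ [P]) = ramChar L + (len P - size P) := by
  simp [ramChar]

/-- The part of the generating function that counts coverings of degree `n`, as a sum over the last
monodromy. -/
def degreeSeries (c : ℂ) (g : ℕ) (D : Fin m → Ptn) (n : ℕ) : Series m k :=
  permSeries c n (fun l G => n - n * (2 - 2 * g) - ramChar (headProfile D l G)) fun l G s =>
    tailWeight g n (headProfile D l G) s / ((n ! : ℂ) * ∏ j, ((l j)! : ℂ))

theorem PhiDeg_apply (g : ℕ) (D : Fin m → Ptn) (n : ℕ) (e : ℤ) (l : Fin m → ℕ) (G : Fin k → Ptn)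
    (P : Ptn) :
    PhiDeg g D n e l G P = (if n * (2 - 2 * g) + ramChar (profile D l G P) = -e then
      rawNumber g n (profile D l G P) / (n ! : ℂ) else 0) / ∏ j, ((l j)! : ℂ) := by
  rw [PhiDeg]
  by_cases he : ∃ h : ℤ, 2 * h - 2 = e
  · obtain ⟨h, rfl⟩ := he
    rw [finsum_eq_single _ h]
    · rw [finsum_eq_if, if_pos rfl, U_eq]
      simp only [show (2 - 2 * h : ℤ) = -(2 * h - 2) by ring]
    · intro h' hh'
      rw [finsum_eq_if, if_neg fun h'' => hh' (by omega)]
  · rw [finsum_eq_zero_of_forall_eq_zero]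
    · split_ifs with h1
      · have : rawNumber g n (profile D l G P) = 0 := by
          by_contra h2
          obtain ⟨r, hr⟩ := even_ramChar_of_rawNumber_ne_zero h2
          refine he ⟨1 - n * (1 - g) - r, ?_⟩
          rw [hr] at h1
          linarith
        rw [this]
        simp
      · simp
    · intro h
      rw [finsum_eq_if, if_neg fun h' => he ⟨h, h'⟩]

/-- The sum over Γ and its marks is the expansion of the shifted monomial of `ptype s`; the
exponents of z agree because l(type of s) = l(Γ) + n - |Γ|. -/
theorem PhiDeg_eq_degreeSeries (g : ℕ) (D : Fin m → Ptn) (n : ℕ) :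
    (PhiDeg g D n : Series m k) = degreeSeries 1 g D n := by
  funext e l G
  ext P
  rw [MvPowerSeries.coeff_apply, PhiDeg_apply, degreeSeries, permSeries, map_sum, profile_eq,
    rawNumber_append_singleton, ramChar_append_singleton]
  have h1 : ∀ (p : Prop) [Decidable p] (x : ℂ), (if p then x else 0) = (if p then 1 else 0) * x :=
    fun p _ x => by split_ifs <;> simp
  rw [h1, Finset.sum_div, Finset.mul_sum, Finset.sum_div]
  refine Finset.sum_congr rfl fun s _ => ?_
  rw [MvPowerSeries.coeff_smul, coeff_mon_timeShift, one_pow, mul_one]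
  by_cases hs : shiftCount (ptype s) P = 0
  · simp [hs]
  · obtain ⟨h2, h3⟩ := shiftCount_ne_zero hs
    rw [size_ptype, Fintype.card_fin] at h2 h3
    have h4 : len (ptype s) = len P + (n - size P) := by
      conv_lhs => rw [h2, len_add, len_single]
    have h5 : (n * (2 - 2 * g) + (ramChar (headProfile D l G) + (len P - size P)) = -e) ↔
        e = n - n * (2 - 2 * g) - ramChar (headProfile D l G) - len (ptype s) := by
      rw [h4]
      push_cast [h3]
      constructor <;> intro h <;> linarith
    simp only [h5]
    have hn : (n ! : ℂ) ≠ 0 := by exact_mod_cast (Nat.factorial_pos _).ne'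
    have hl : (∏ j, ((l j)! : ℂ)) ≠ 0 :=
      Finset.prod_ne_zero_iff.mpr fun j _ => by exact_mod_cast (Nat.factorial_pos _).ne'
    field_simp

/-- The shift c enters as c^(n - |P|), and for c = 0 this is the indicator of n = |P|. -/
theorem coeff_degreeSeries_zero (g : ℕ) (D : Fin m → Ptn) (n : ℕ) (e : ℤ) (l : Fin m → ℕ)
    (G : Fin k → Ptn) (P : Ptn) :
    MvPowerSeries.coeff P (degreeSeries 0 g D n e l G) =
      if n = size P then MvPowerSeries.coeff P (degreeSeries 1 g D n e l G) else 0 := by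
  rw [degreeSeries, degreeSeries, permSeries, permSeries, map_sum, map_sum]
  have key : ∀ (c : ℂ) (s : Equiv.Perm (Fin n)), MvPowerSeries.coeff P (mon (timeShift c) (ptype s)) =
      shiftCount (ptype s) P * c ^ (n - size P) := by
    intro c s
    rw [coeff_mon_timeShift]
    by_cases hs : shiftCount (ptype s) P = 0
    · simp [hs]
    · have h := DFunLike.congr_fun (shiftCount_ne_zero hs).1 1
      rw [size_ptype, Fintype.card_fin, Finsupp.add_apply, Finsupp.single_eq_same] at h
      rw [h, Nat.add_sub_cancel_left]
  simp only [MvPowerSeries.coeff_smul, key, one_pow, mul_one]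
  split_ifs with h
  · subst h
    simp
  · refine Finset.sum_eq_zero fun s _ => ?_
    by_cases hs : shiftCount (ptype s) P = 0
    · simp [hs]
    · have h1 := (shiftCount_ne_zero hs).2
      rw [size_ptype, Fintype.card_fin] at h1
      rw [zero_pow (by omega)]
      ring

theorem PhiUnshifted_eq (g : ℕ) (D : Fin m → Ptn) :
    (PhiUnshifted g D : Series m k) = coeffSum fun n => degreeSeries 0 g D n := by
  funext e l G P
  rw [coeffSum, finsum_eq_single _ (size P) fun n hn => by
    rw [coeff_degreeSeries_zero, if_neg hn], coeff_degreeSeries_zero, if_pos rfl, PhiUnshifted,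
    PhiDeg_eq_degreeSeries]

theorem Phi_eq (g : ℕ) (D : Fin m → Ptn) :
    (Phi g D : Series m k) = coeffSum fun n => PhiDeg g D n := rfl

/-- The exponent of z fixes n(2 - 2g), hence n if g ≠ 1; at most one degree contributes. -/
theorem finite_PhiDeg_ne_zero {g : ℕ} (hg : g ≠ 1) (D : Fin m → Ptn) (e : ℤ) (l : Fin m → ℕ)
    (G : Fin k → Ptn) (P : Ptn) :
    {n : ℕ | MvPowerSeries.coeff P (PhiDeg g D n e l G) ≠ 0}.Finite := by
  refine Set.Subsingleton.finite fun n hn n' hn' => ?_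
  have key : ∀ n : ℕ, MvPowerSeries.coeff P (PhiDeg g D n e l G) ≠ 0 →
      (n : ℤ) * (2 - 2 * g) + ramChar (profile D l G P) = -e := by
    intro n hn
    rw [MvPowerSeries.coeff_apply, PhiDeg_apply] at hn
    by_contra h
    rw [if_neg h, zero_div] at hn
    exact hn rfl
  have h1 := key n hn
  have h2 := key n' hn'
  have h3 : ((n : ℤ) - n') * (2 - 2 * g) = 0 := by linarith
  rcases mul_eq_zero.mp h3 with h | h
  · omega
  · omega

/-! ### The evolution equations -/

/-- The factor l_i + 1 from the derivative cancels against (l_i + 1)!, and the extra copy of Δ_i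
changes the weights by the convolution of `W_permSeries`. -/
theorem partialU_degreeSeries (c : ℂ) (g : ℕ) (D : Fin m → Ptn) (i : Fin m) (n : ℕ) :
    partialU i (degreeSeries c g D n : Series m k) = W (timeShift c) (D i) (degreeSeries c g D n) := by
  rw [degreeSeries, W_permSeries]
  funext e l G
  rw [partialU, permSeries, permSeries, Finset.smul_sum]
  refine Finset.sum_congr rfl fun s _ => ?_
  rw [smul_smul]
  congr 1
  have hperm := headProfile_add_single D l G i
  have h1 : ramChar (headProfile D (l + Pi.single i 1) G) =
      ramChar (headProfile D l G) + (len (D i) - size (D i)) := by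
    rw [ramChar_perm hperm, ramChar, List.map_cons, List.sum_cons, add_comm]
    rfl
  have h2 : ∏ j, (((l + Pi.single i 1 : Fin m → ℕ) j)! : ℂ) = ((l i : ℂ) + 1) * ∏ j, ((l j)! : ℂ) := by
    rw [← Finset.mul_prod_erase _ _ (Finset.mem_univ i),
      ← Finset.mul_prod_erase _ (fun j => ((l j)! : ℂ)) (Finset.mem_univ i),
      Finset.prod_congr rfl (g := fun j => ((l j)! : ℂ)) fun j hj => by
        simp [Finset.ne_of_mem_erase hj]]
    simp only [Pi.add_apply, Pi.single_eq_same, Nat.factorial_succ]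
    push_cast
    ring
  have h3 : ((l i : ℂ) + 1) ≠ 0 := Nat.cast_add_one_ne_zero _
  have hn : (n ! : ℂ) ≠ 0 := by exact_mod_cast (Nat.factorial_pos _).ne'
  have hl : (∏ j, ((l j)! : ℂ)) ≠ 0 :=
    Finset.prod_ne_zero_iff.mpr fun j _ => by exact_mod_cast (Nat.factorial_pos _).ne'
  have h4 : ((n : ℤ) - n * (2 - 2 * g) - (ramChar (headProfile D l G) + (len (D i) - size (D i)))) =
      n - n * (2 - 2 * g) - ramChar (headProfile D l G) + (size (D i) - len (D i)) := by ring
  rw [h1, h2, h4, tailWeight_perm g n hperm, tailWeight_cons, ← mul_assoc]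
  congr 1
  simp only [mul_div_assoc', ← Finset.sum_div]
  field_simp

theorem partialU_coeffSum (i : Fin m) (F : ℕ → Series m k) :
    partialU i (coeffSum F) = coeffSum fun n => partialU i (F n) := by
  funext e l G P
  simp only [partialU, coeffSum, MvPowerSeries.coeff_smul]
  rw [← mul_finsum]
  rfl

theorem partialU_PhiDeg (g : ℕ) (D : Fin m → Ptn) (i : Fin m) (n : ℕ) :
    partialU i (PhiDeg g D n : Series m k) = W shiftedTimeVar (D i) (PhiDeg g D n) := by
  rw [PhiDeg_eq_degreeSeries, partialU_degreeSeries, timeShift_one]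

theorem partialU_Phi {g : ℕ} (hg : g ≠ 1) (D : Fin m → Ptn) (i : Fin m) :
    partialU i (Phi g D : Series m k) = W shiftedTimeVar (D i) (Phi g D) := by
  rw [Phi_eq, partialU_coeffSum, ← timeShift_one,
    W_coeffSum _ _ _ fun e l G P => finite_PhiDeg_ne_zero hg D e l G P, timeShift_one]
  simp only [partialU_PhiDeg]

theorem partialU_PhiUnshifted (g : ℕ) (D : Fin m → Ptn) (i : Fin m) :
    partialU i (PhiUnshifted g D : Series m k) = W timeVar (D i) (PhiUnshifted g D) := by
  rw [PhiUnshifted_eq, partialU_coeffSum, ← timeShift_zero, W_coeffSum]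
  · simp only [partialU_degreeSeries]
  · intro e l G P
    refine (Set.finite_singleton (size P)).subset fun n hn => ?_
    by_contra h
    exact hn ((coeff_degreeSeries_zero g D n e l G P).trans (if_neg h))

end Generating

end

end ShiftedHurwitz

theorem mainTheorem4 (g m k : ℕ) (Δ : Fin m → Ptn) (i : Fin m) :
    -- the operators are well defined on all formal series
    IsLocallyFinite timeVar m k (Δ i) ∧
    IsLocallyFinite shiftedTimeVar m k (Δ i) ∧
    -- the evolution equation for the generating function, which is well defined for `g ≠ 1`
    (g ≠ 1 →
      (∀ (e : ℤ) (l : Fin m → ℕ) (G : Fin k → Ptn) (P : Ptn),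
        {n : ℕ | MvPowerSeries.coeff P (PhiDeg g Δ n e l G) ≠ 0}.Finite) ∧
      partialU i (Phi g Δ : Series m k) = W shiftedTimeVar (Δ i) (Phi g Δ)) ∧
    -- the evolution equation in each degree, for every target genus
    (∀ n : ℕ, partialU i (PhiDeg g Δ n : Series m k) =
      W shiftedTimeVar (Δ i) (PhiDeg g Δ n)) ∧
    -- the evolution equation for the part with unshifted last ramification type
    partialU i (PhiUnshifted g Δ : Series m k) = W timeVar (Δ i) (PhiUnshifted g Δ) := by
  refine ⟨timeShift_zero ▸ isLocallyFinite_timeShift 0 m k (Δ i),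
    timeShift_one ▸ isLocallyFinite_timeShift 1 m k (Δ i),
    fun hg => ⟨fun e l G P => finite_PhiDeg_ne_zero hg Δ e l G P, partialU_Phi hg Δ i⟩,
    fun n => partialU_PhiDeg g Δ i n, partialU_PhiUnshifted g Δ i⟩
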